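/- **Conventions.** A digraph $\Gamma$ has a vertex set $V\Gamma$ and an arc set $A\Gamma\subseteq V\Gamma\times V\Gamma$ such that $(u,v)\in A\Gamma$ implies $(v,u)\notin A\Gamma$. It is connected, respectively bipartite, if its underlying undirected graph is; it has valency $k$ if every vertex has exactly $k$ out-neighbours and exactly $k$ in-neighbours. An $s$-arc is a sequence $(v_0,\dots,v_s)$ of vertices with $(v_i,v_{i+1})\in A\Gamma$ for $0\le i<s$. For $G\le\mathrm{Aut}(\Gamma)$, $\Gamma$ is $(G,s)$-arc-transitive if $G$ is transitive on the set of $s$-arcs. For $N\unlhd G$ with $G$ vertex-transitive, the $G$-normal quotient $\Gamma_N$ has as vertices the $N$-orbits in $V\Gamma$, with an arc $(U,U')$ whenever $(u,u')\in A\Gamma$ for some $u\in U$, $u'\in U'$. Let $\mathrm C_r^{\to}$ be the directed cycle of length $r$. Let $\mathcal D$ be the family of triples $(\Gamma,G,s)$ such that $\Gamma$ is a finite connected digraph, $G\le \mathrm{Aut}(\Gamma)$, $s\ge 2$, $\Gamma$ is $G$-vertex-transitive and $(G,s)$-arc-transitive, and no $G$-normal quotient of $\Gamma$ is isomorphic to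 $\mathrm C_r^{\to}$ for any $r\ge3$. A permutation group $G$ on a set $V$ is quasiprimitive if each nontrivial normal subgroup is transitive on $V$; it is bi-quasiprimitive if each nontrivial normal subgroup has at most two orbits in $V$ (of equal length) and some normal subgroup has exactly two orbits. **Construction.** Let $k,s,n$ be positive integers with $k\ge 2$ and $\gcd(n,s+1)=1$. In $\mathrm{Sym}((s+1)k+n)$, acting on $\{1,\dots,(s+1)k+n\}$ on the right, let $$x_i=((i-1)k+1,(i-1)k+2,\dots,ik)\quad(1\le i\le s+1),$$ $$y_1=(1,k+1,\dots,sk+1,(s+1)k+1,(s+1)k+2,\dots,(s+1)k+n),$$ $$y_i=(i,k+i,\dots,sk+i)\quad(2\le i\le k),\qquad a=y_1y_2\cdots y_k .$$ Put $H=\langle x_1,\dots,x_{s+1}\rangle$, $X=\langle H,a\rangle$, and let $\Delta=\Delta(k,s,n)$ be the digraph with vertex set $\{Hx\mid x\in X\}$ and arc set $\{(Hx,Hax)\mid x\in X\}$, on which $X$ acts by right multiplication. **Proposition.** For all such $k,s,n$, precisely one of the following five lines holds (in column $X$, Alt and Sym mean $X=\mathrm{Alt}((s+1)k+n)$ and $X=\mathrm{Sym}((s+1)k+n)$;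 a dash means no condition): $$\begin{array}{c|cccccc} \text{Line}&k&n&s&X&X\text{-action on }V\Delta&\Delta\text{ bipartite?}\\\hline 1&\text{even}&\text{even}&\text{even}&\mathrm{Sym}&\text{quasiprimitive}&\text{no}\\ 2&\text{even}&\text{odd}&-&\mathrm{Sym}&\text{quasiprimitive}&\text{no}\\ 3&\text{odd}&\text{odd}&\text{odd}&\mathrm{Alt}&\text{quasiprimitive}&\text{no}\\ 4&\text{odd}&\text{even}&\text{even}&\mathrm{Alt}&\text{quasiprimitive}&\text{no}\\ 5&\text{odd}&\text{odd}&\text{even}&\mathrm{Sym}&\text{bi-quasiprimitive}&\text{yes} \end{array}$$ Moreover $(\Delta,X,s)$ satisfies all the conditions defining $\mathcal D$ except possibly $s\ge2$, so that $(\Delta,X,s)\in\mathcal D$ whenever $s\ge 2$; and: 1. $X$ acts bi-quasiprimitively on $V\Delta$ if and only if $kn$ is odd and $s$ is even; 2. for each even $s\ge2$ and each odd $k>1$, (i) there are infinitely many positive integers $n$ with $\gcd(n,s+1)=1$ such that $(\Delta,X,s)\in\mathcal D$ with $\Delta$ of valency $k$ and $X$ bi-quasiprimitive on $V\Delta$;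 (ii) there are infinitely many positive integers $n$ with $\gcd(n,s+1)=1$ such that $(\Delta,X,s)\in\mathcal D$ with $\Delta$ of valency $k$ and $X$ quasiprimitive on $V\Delta$. -/

import Mathlib

/-! ### Permutation group actions -/

/-- A (faithful) action of `G` on `V` is quasiprimitive if each nontrivial normal subgroup of `G`
is transitive on `V`. -/
def IsQuasiprimitiveAction (G V : Type*) [Group G] [MulAction G V] : Prop :=
  ∀ N : Subgroup G, N.Normal → N ≠ ⊥ → MulAction.IsPretransitive N V

/-- For a faithful transitive action this is Mathlib's notion. -/
theorem isQuasiprimitiveAction_iff (G V : Type*) [Group G] [MulAction G V] [FaithfulSMul G V]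
    [MulAction.IsPretransitive G V] :
    IsQuasiprimitiveAction G V ↔ MulAction.IsQuasiPreprimitive G V := by
  constructor
  · intro h
    refine ⟨fun {N} hN hfix => h N hN ?_⟩
    rintro rfl
    apply hfix
    ext v
    simp only [MulAction.mem_fixedPoints, Set.mem_univ, iff_true]
    rintro ⟨g, hg⟩
    obtain rfl := Subgroup.mem_bot.mp hg
    exact one_smul G v
  · intro h N hN hne
    refine h.isPretransitive_of_normal (fun hfix => hne ?_)
    refine (Subgroup.eq_bot_iff_forall N).mpr (fun g hg => ?_)
    refine eq_of_smul_eq_smul (α := V) (fun v => ?_)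
    have hv : v ∈ MulAction.fixedPoints N V := hfix ▸ Set.mem_univ v
    rw [one_smul]
    exact hv ⟨g, hg⟩

/-- All orbits of `G` on `V` have the same cardinality. -/
def HasEqualLengthOrbits (G V : Type*) [Group G] [MulAction G V] : Prop :=
  ∀ v w : V, (MulAction.orbit G v).encard = (MulAction.orbit G w).encard

/-- A (faithful) action of `G` on `V` is bi-quasiprimitive if each nontrivial normal subgroup of
`G` has at most two orbits in `V`, of equal length, and some normal subgroup has exactly two. -/
def IsBiquasiprimitiveAction (G V : Type*) [Group G] [MulAction G V] : Prop :=
  (∀ N : Subgroup G, N.Normal → N ≠ ⊥ →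
    ENat.card (MulAction.orbitRel.Quotient N V) ≤ 2 ∧ HasEqualLengthOrbits N V) ∧
  ∃ N : Subgroup G, N.Normal ∧ ENat.card (MulAction.orbitRel.Quotient N V) = 2

/-! ### Digraphs -/

namespace Digraph

/-- The digraphs of interest: if `(u, v)` is an arc then `(v, u)` is not (so no loops either). -/
def IsAsymm {V : Type*} (Γ : Digraph V) : Prop :=
  ∀ u v, Γ.Adj u v → ¬ Γ.Adj v u

/-- The type of `s`-arcs: sequences `(v_0, …, v_s)` with each `(v_i, v_{i+1})` an arc. -/
def SArc {V : Type*} (Γ : Digraph V) (s : ℕ) : Type _ :=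
  {v : Fin (s + 1) → V // ∀ i : Fin s, Γ.Adj (v i.castSucc) (v i.succ)}

/-- `G` acts on `V` faithfully and by automorphisms of `Γ`, that is, `G ≤ Aut Γ`. -/
def IsAutGroup {V : Type*} (Γ : Digraph V) (G : Type*) [Group G] [MulAction G V] : Prop :=
  FaithfulSMul G V ∧ ∀ (g : G) (u v : V), Γ.Adj (g • u) (g • v) ↔ Γ.Adj u v

/-- `G` is transitive on the set of `s`-arcs of `Γ`. -/
def IsSArcTransitive {V : Type*} (Γ : Digraph V) (G : Type*) [Group G] [MulAction G V]
    (s : ℕ) : Prop :=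
  ∀ p q : Γ.SArc s, ∃ g : G, ∀ i, g • p.1 i = q.1 i

/-- Every vertex has out-valency `k` and in-valency `k`. -/
def HasValency {V : Type*} (Γ : Digraph V) (k : ℕ) : Prop :=
  ∀ v, {w | Γ.Adj v w}.encard = k ∧ {w | Γ.Adj w v}.encard = k

/-- The quotient `Γ_N` on the set of `N`-orbits. -/
def orbitQuotient {V : Type*} (Γ : Digraph V) (N : Type*) [Group N] [MulAction N V] :
    Digraph (MulAction.orbitRel.Quotient N V) where
  Adj U U' := ∃ u u' : V, Quotient.mk (MulAction.orbitRel N V) u = U ∧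
    Quotient.mk (MulAction.orbitRel N V) u' = U' ∧ Γ.Adj u u'

/-- The directed cycle of length `r` (used for `r ≥ 3`). -/
def directedCycle (r : ℕ) : Digraph (ZMod r) where
  Adj i j := j = i + 1

/-- No `G`-normal quotient of `Γ` is isomorphic to a directed cycle of length `r ≥ 3`. -/
def NoCyclicNormalQuotient {V : Type*} (Γ : Digraph V) (G : Type*) [Group G] [MulAction G V] :
    Prop :=
  ∀ N : Subgroup G, N.Normal → ∀ r : ℕ, 3 ≤ r →
    IsEmpty ((Γ.orbitQuotient N).Adj ≃r (directedCycle r).Adj)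

/-- All the conditions for `(Γ, G, s)` to lie in the family `𝒟`, apart from `s ≥ 2`. -/
structure IsPreFamilyD {V : Type*} (Γ : Digraph V) (G : Type*) [Group G] [MulAction G V]
    (s : ℕ) : Prop where
  finite : Finite V
  asymm : Γ.IsAsymm
  connected : Γ.toSimpleGraphInclusive.Connected
  autGroup : Γ.IsAutGroup G
  vertexTransitive : MulAction.IsPretransitive G V
  sArcTransitive : Γ.IsSArcTransitive G s
  noCyclicQuotient : Γ.NoCyclicNormalQuotient G

/-- `(Γ, G, s)` lies in the family `𝒟`: `Γ` is a finite connected `G`-vertex-transitive,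
`(G, s)`-arc-transitive digraph with `G ≤ Aut Γ`, `s ≥ 2`, and no `G`-normal quotient is a directed
cycle of length at least `3`. -/
structure MemFamilyD {V : Type*} (Γ : Digraph V) (G : Type*) [Group G] [MulAction G V]
    (s : ℕ) : Prop extends Γ.IsPreFamilyD G s where
  two_le : 2 ≤ s

end Digraph

/-! ### The digraphs `Δ(k, s, n)`

The points `1, …, (s + 1) k + n` are represented by `0, …, (s + 1) k + n - 1`, so all labels below
are shifted down by one; the indices `i`, `j` of `x_i`, `y_j` are shifted likewise. -/

namespace CLP

/-- The point set, with `(s + 1) k + n` elements. -/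
abbrev Pt (k s n : ℕ) : Type := Fin ((s + 1) * k + n)

/-- The point `i k + j` of the `i`-th block, for `0 ≤ i ≤ s` and `0 ≤ j < k`. -/
def blockPt (k s n : ℕ) (i : Fin (s + 1)) (j : Fin k) : Pt k s n :=
  ⟨i * k + j, by
    have h : ((i : ℕ) + 1) * k ≤ (s + 1) * k := Nat.mul_le_mul_right k i.2
    have hj := j.2
    rw [Nat.add_mul, Nat.one_mul] at h
    omega⟩

/-- The last `n` points `(s + 1) k + t`, for `0 ≤ t < n`. -/
def tailPt (k s n : ℕ) (t : Fin n) : Pt k s n :=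
  ⟨(s + 1) * k + t, Nat.add_lt_add_left t.2 _⟩

/-- The cycle `x_i = (i k, i k + 1, …, i k + k - 1)`. -/
def x (k s n : ℕ) (i : Fin (s + 1)) : Equiv.Perm (Pt k s n) :=
  (List.ofFn fun j : Fin k => blockPt k s n i j).formPerm

/-- The cycle `y_j = (j, k + j, …, s k + j)`, extended for `j = 0` by the last `n` points. -/
def y (k s n : ℕ) (j : Fin k) : Equiv.Perm (Pt k s n) :=
  ((List.ofFn fun i : Fin (s + 1) => blockPt k s n i j) ++
    (if (j : ℕ) = 0 then List.ofFn (tailPt k s n) else [])).formPerm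

/-- The product of the (pairwise disjoint) cycles `y_j`. -/
def a (k s n : ℕ) : Equiv.Perm (Pt k s n) :=
  (List.ofFn (y k s n)).prod

/-- `H = ⟨x_1, …, x_{s+1}⟩`. -/
def H (k s n : ℕ) : Subgroup (Equiv.Perm (Pt k s n)) :=
  Subgroup.closure (Set.range (x k s n))

/-- `X = ⟨H, a⟩`. -/
def X (k s n : ℕ) : Subgroup (Equiv.Perm (Pt k s n)) :=
  H k s n ⊔ Subgroup.closure {a k s n}

theorem a_mem_X (k s n : ℕ) : a k s n ∈ X k s n :=
  (le_sup_right : Subgroup.closure {a k s n} ≤ X k s n)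
    (Subgroup.subset_closure (Set.mem_singleton _))

/-- The set of cosets of `H` in `X`. Permutations are classically composed from left to right here,
whereas `g * h` in `Equiv.Perm` means first `h`, then `g`; so the classical right coset
`H x = {h x | h ∈ H}` is the set written `x • H` below, and the classical action of `X` by right
multiplication is the action of `X` by left multiplication on `X ⧸ H`. -/
abbrev Vert (k s n : ℕ) : Type := X k s n ⧸ (H k s n).subgroupOf (X k s n)

/-- The digraph `Δ(k, s, n)`: its arcs are the pairs `(H x, H a x)` for `x ∈ X`, where products are
read from left to right, that is, `(g H, g a H)` for `g ∈ X` in Mathlib's convention. -/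
def Δ (k s n : ℕ) : Digraph (Vert k s n) where
  Adj u v := ∃ g : X k s n, u = QuotientGroup.mk g ∧
    v = QuotientGroup.mk (g * ⟨a k s n, a_mem_X k s n⟩)

/-- `X` is the alternating group on the points, acts quasiprimitively on the vertices, and
`Δ(k, s, n)` is not bipartite. -/
def AltQuasiprimitive (k s n : ℕ) : Prop :=
  X k s n = alternatingGroup (Pt k s n) ∧ IsQuasiprimitiveAction (X k s n) (Vert k s n) ∧
    ¬ (Δ k s n).toSimpleGraphInclusive.IsBipartite

/-- `X` is the symmetric group on the points, acts quasiprimitively on the vertices, and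
`Δ(k, s, n)` is not bipartite. -/
def SymQuasiprimitive (k s n : ℕ) : Prop :=
  X k s n = ⊤ ∧ IsQuasiprimitiveAction (X k s n) (Vert k s n) ∧
    ¬ (Δ k s n).toSimpleGraphInclusive.IsBipartite

/-- `X` is the symmetric group on the points, acts bi-quasiprimitively on the vertices, and
`Δ(k, s, n)` is bipartite. -/
def SymBiquasiprimitive (k s n : ℕ) : Prop :=
  X k s n = ⊤ ∧ IsBiquasiprimitiveAction (X k s n) (Vert k s n) ∧
    (Δ k s n).toSimpleGraphInclusive.IsBipartite

/-- The five lines (numbered `0, …, 4`) of the table of parities and properties. -/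
def TableLine (k s n : ℕ) : Fin 5 → Prop :=
  ![Even k ∧ Even n ∧ Even s ∧ SymQuasiprimitive k s n,
    Even k ∧ Odd n ∧ SymQuasiprimitive k s n,
    Odd k ∧ Odd n ∧ Odd s ∧ AltQuasiprimitive k s n,
    Odd k ∧ Even n ∧ Even s ∧ AltQuasiprimitive k s n,
    Odd k ∧ Odd n ∧ Even s ∧ SymBiquasiprimitive k s n]

end CLP

/-!
The points form `s + 1` rows of length `k`, permuted cyclically by the `x_i`, and `n` tail points;
`a` moves along the columns, and the column of index `0` runs through the tail.

**The group.** `X` is transitive on the points. It is primitive: by coprimality, `a ^ (s + 1)` fixes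
all points off the column of index `0` and permutes that column in one cycle, so a block meeting
both parts contains the whole column and then, row by row, everything (`CLP.isBlock_eq_univ`). The
cycles `x_0` and `a x_s a⁻¹` agree but for one point, so that their quotient is a 3-cycle
(`CLP.isThreeCycle_x_mul`). By Jordan's theorem `X` contains the alternating group, and the signs of
`x_i` and `a` decide which of the two groups it is.

**The action on vertices.** There are at least five points, so every nontrivial normal subgroup of
`X` contains all even permutations (`CLP.mem_of_normal`). It is therefore transitive on the cosets
of `H` if `H` meets every coset of the alternating group in `X`. Otherwise `H` is even and `a` is
odd; then the sign is well defined on vertices, distinguishes the two orbits of the alternating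
group and gives a bipartition. In the quasiprimitive case there is no bipartition, because its
stabiliser would be an intransitive nontrivial normal subgroup (`cosetDigraph.not_isBipartite`).

**The digraph.** Conjugation by `a` takes `x_i` to `x_{i+1}` for `i < s`. Hence the out-neighbours of
`H` are the `k` vertices `x_0 ^ m a H`, and `x_t` fixes the standard `t`-arc `(H, a H, …, a ^ t H)`
while permuting its extensions transitively, which gives `s`-arc-transitivity by induction
(`cosetDigraph.isSArcTransitive`). A nontrivial normal subgroup has at most two orbits and `Δ` itself
has valency `k ≥ 2`, so no normal quotient is a directed cycle of length at least `3`.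
-/

/-! ### Permutations given by lists -/

theorem List.conj_formPerm {α : Type*} [DecidableEq α] (σ : Equiv.Perm α) (l : List α) :
    σ * l.formPerm * σ⁻¹ = (l.map σ).formPerm := by
  induction l with
  | nil => simp
  | cons p l ih =>
    cases l with
    | nil => simp
    | cons q l =>
      simp only [List.map_cons, List.formPerm_cons_cons] at ih ⊢
      rw [← ih, ← mul_assoc, Equiv.mul_swap_eq_swap_mul]
      simp only [mul_assoc]

theorem List.sign_formPerm {α : Type*} [DecidableEq α] [Fintype α] {l : List α} (hl : l.Nodup) :
    Equiv.Perm.sign l.formPerm = (-1) ^ (l.length - 1) := by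
  induction l with
  | nil => simp
  | cons p l ih =>
    cases l with
    | nil => simp
    | cons q l =>
      have hpq : p ≠ q := by
        rintro rfl
        simp at hl
      rw [List.formPerm_cons_cons, map_mul, Equiv.Perm.sign_swap hpq, ih hl.of_cons]
      simp [pow_succ']

namespace CLP

variable {k s n : ℕ}

/-! ### The points -/

theorem blockPt_inj {i i' : Fin (s + 1)} {j j' : Fin k} :
    blockPt k s n i j = blockPt k s n i' j' ↔ i = i' ∧ j = j' := by
  constructor
  · intro h
    have h' : (i : ℕ) * k + j = i' * k + j' := congrArg Fin.val h
    have hk : 0 < k := j.pos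
    have e1 : ((i : ℕ) * k + j) / k = i := by
      rw [mul_comm, Nat.mul_add_div hk, Nat.div_eq_of_lt j.2, add_zero]
    have e2 : ((i' : ℕ) * k + j') / k = i' := by
      rw [mul_comm, Nat.mul_add_div hk, Nat.div_eq_of_lt j'.2, add_zero]
    have e : (i : ℕ) = i' := by rw [← e1, ← e2, h']
    rw [e] at h'
    exact ⟨Fin.ext e, Fin.ext (by omega)⟩
  · rintro ⟨rfl, rfl⟩
    rfl

theorem blockPt_ne_tailPt (i : Fin (s + 1)) (j : Fin k) (t : Fin n) :
    blockPt k s n i j ≠ tailPt k s n t := by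
  intro h
  have h' : (i : ℕ) * k + j = (s + 1) * k + t := congrArg Fin.val h
  have h1 : ((i : ℕ) + 1) * k ≤ (s + 1) * k := Nat.mul_le_mul_right k i.2
  have := j.2
  rw [Nat.add_mul, Nat.one_mul] at h1
  omega

theorem tailPt_injective : Function.Injective (tailPt k s n) := by
  intro t t' h
  have h' : (s + 1) * k + (t : ℕ) = (s + 1) * k + t' := congrArg Fin.val h
  exact Fin.ext (by omega)

theorem exists_eq_blockPt_or_tailPt (p : Pt k s n) :
    (∃ i j, p = blockPt k s n i j) ∨ ∃ t, p = tailPt k s n t := by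
  by_cases hp : (p : ℕ) < (s + 1) * k
  · left
    have hk : 0 < k := by
      rcases Nat.eq_zero_or_pos k with rfl | h
      · simp at hp
      · exact h
    refine ⟨⟨p / k, (Nat.div_lt_iff_lt_mul hk).2 hp⟩, ⟨p % k, Nat.mod_lt _ hk⟩, Fin.ext ?_⟩
    change (p : ℕ) = p / k * k + p % k
    exact (Nat.div_add_mod' _ _).symm
  · right
    refine ⟨⟨p - (s + 1) * k, by have := p.2; omega⟩, Fin.ext ?_⟩
    change (p : ℕ) = (s + 1) * k + (p - (s + 1) * k)
    omega

/-! ### The row cycles -/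

/-- The list of points of the `i`-th block, in the order in which `x_i` permutes them. -/
def rowList (k s n : ℕ) (i : Fin (s + 1)) : List (Pt k s n) :=
  List.ofFn fun j : Fin k => blockPt k s n i j

theorem x_eq_formPerm (i : Fin (s + 1)) : x k s n i = (rowList k s n i).formPerm := rfl

theorem length_rowList (i : Fin (s + 1)) : (rowList k s n i).length = k := List.length_ofFn

theorem nodup_rowList (i : Fin (s + 1)) : (rowList k s n i).Nodup :=
  List.nodup_ofFn.2 fun _ _ h => (blockPt_inj.1 h).2

theorem mem_rowList {i : Fin (s + 1)} {p : Pt k s n} :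
    p ∈ rowList k s n i ↔ ∃ j, blockPt k s n i j = p := by
  simp [rowList, List.mem_ofFn]

theorem isCycle_x (hk : 2 ≤ k) (i : Fin (s + 1)) : (x k s n i).IsCycle :=
  List.isCycle_formPerm (nodup_rowList i) ((length_rowList i).symm ▸ hk)

theorem sign_x (i : Fin (s + 1)) : Equiv.Perm.sign (x k s n i) = (-1) ^ (k - 1) := by
  rw [x_eq_formPerm, List.sign_formPerm (nodup_rowList i), length_rowList]

theorem orderOf_x (hk : 2 ≤ k) (i : Fin (s + 1)) : orderOf (x k s n i) = k := by
  rw [(isCycle_x hk i).orderOf, x_eq_formPerm, List.support_formPerm_of_nodup _ (nodup_rowList i),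
    List.toFinset_card_of_nodup (nodup_rowList i), length_rowList]
  intro p hp
  have := congrArg List.length hp
  rw [length_rowList, List.length_singleton] at this
  omega

theorem x_apply_tailPt (i : Fin (s + 1)) (t : Fin n) :
    x k s n i (tailPt k s n t) = tailPt k s n t :=
  List.formPerm_apply_of_notMem fun h => by
    obtain ⟨j, hj⟩ := mem_rowList.1 h
    exact blockPt_ne_tailPt _ _ _ hj

theorem x_apply_blockPt_of_ne {i i' : Fin (s + 1)} (h : i ≠ i') (j : Fin k) :
    x k s n i (blockPt k s n i' j) = blockPt k s n i' j :=
  List.formPerm_apply_of_notMem fun h' => by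
    obtain ⟨j', hj⟩ := mem_rowList.1 h'
    exact h (blockPt_inj.1 hj).1

theorem x_pow_apply_blockPt (i : Fin (s + 1)) (j : Fin k) (m : ℕ) :
    (x k s n i ^ m) (blockPt k s n i j) =
      blockPt k s n i ⟨(j + m) % k, Nat.mod_lt _ j.pos⟩ := by
  have h := List.formPerm_pow_apply_getElem (rowList k s n i) (nodup_rowList i) m j
    (by rw [length_rowList]; exact j.2)
  simp only [length_rowList] at h
  simpa [rowList, x_eq_formPerm] using h

theorem x_apply_blockPt_ne (hk : 2 ≤ k) (i : Fin (s + 1)) (j : Fin k) :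
    x k s n i (blockPt k s n i j) ≠ blockPt k s n i j := by
  rw [x_eq_formPerm, Ne, List.formPerm_apply_mem_eq_self_iff _ (nodup_rowList i) _
    (mem_rowList.2 ⟨j, rfl⟩), length_rowList]
  omega

theorem x_commute (i i' : Fin (s + 1)) : Commute (x k s n i) (x k s n i') := by
  by_cases h : i = i'
  · rw [h]
  refine Equiv.Perm.Disjoint.commute fun p => ?_
  rcases exists_eq_blockPt_or_tailPt p with ⟨i₁, j, rfl⟩ | ⟨t, rfl⟩
  · by_cases h1 : i = i₁
    · exact Or.inr (x_apply_blockPt_of_ne (fun h2 => h (h1.trans h2.symm)) j)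
    · exact Or.inl (x_apply_blockPt_of_ne h1 j)
  · exact Or.inl (x_apply_tailPt i t)

/-! ### The column cycles and their product -/

/-- The list of points of the `j`-th column, in the order in which `y_j` permutes them; the column
of index `0` includes the last `n` points. -/
def colList (k s n : ℕ) (j : Fin k) : List (Pt k s n) :=
  (List.ofFn fun i : Fin (s + 1) => blockPt k s n i j) ++
    (if (j : ℕ) = 0 then List.ofFn (tailPt k s n) else [])

theorem y_eq_formPerm (j : Fin k) : y k s n j = (colList k s n j).formPerm := rfl

theorem length_colList (j : Fin k) :
    (colList k s n j).length = s + 1 + if (j : ℕ) = 0 then n else 0 := by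
  unfold colList
  split_ifs <;> simp [-List.ofFn_succ]

theorem mem_colList {j : Fin k} {p : Pt k s n} :
    p ∈ colList k s n j ↔
      (∃ i, blockPt k s n i j = p) ∨ (j : ℕ) = 0 ∧ ∃ t, tailPt k s n t = p := by
  unfold colList
  split_ifs with h <;> simp only [h, List.mem_append, List.mem_ofFn, List.not_mem_nil, true_and,
    false_and]

theorem nodup_colList (j : Fin k) : (colList k s n j).Nodup := by
  unfold colList
  refine List.Nodup.append (List.nodup_ofFn.2 fun _ _ h => (blockPt_inj.1 h).1) ?_ ?_
  · split_ifs
    · exact List.nodup_ofFn.2 tailPt_injective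
    · exact List.nodup_nil
  · intro p hp hp'
    split_ifs at hp' with h
    · obtain ⟨i, rfl⟩ := List.mem_ofFn.1 hp
      obtain ⟨t, ht⟩ := List.mem_ofFn.1 hp'
      exact blockPt_ne_tailPt _ _ _ ht.symm
    · simp at hp'

theorem mem_colList_unique {j j' : Fin k} {p : Pt k s n} (h : p ∈ colList k s n j)
    (h' : p ∈ colList k s n j') : j = j' := by
  rcases mem_colList.1 h with ⟨i, rfl⟩ | ⟨h0, t, rfl⟩ <;>
    rcases mem_colList.1 h' with ⟨i', hi⟩ | ⟨h0', t', ht⟩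
  · exact (blockPt_inj.1 hi).2.symm
  · exact absurd ht.symm (blockPt_ne_tailPt _ _ _)
  · exact absurd hi (blockPt_ne_tailPt _ _ _)
  · exact Fin.ext (h0.trans h0'.symm)

theorem sign_y (j : Fin k) :
    Equiv.Perm.sign (y k s n j) = (-1) ^ (s + if (j : ℕ) = 0 then n else 0) := by
  rw [y_eq_formPerm, List.sign_formPerm (nodup_colList j), length_colList, add_right_comm,
    Nat.add_sub_cancel]

theorem sign_a (hk : 0 < k) :
    Equiv.Perm.sign (a k s n) = (-1) ^ (s + n) * ((-1) ^ s) ^ (k - 1) := by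
  obtain ⟨k, rfl⟩ := Nat.exists_eq_add_of_le' hk
  rw [a, map_list_prod, List.map_ofFn, List.prod_ofFn]
  simp only [Function.comp_apply, sign_y]
  rw [Fin.prod_univ_succ]
  simp

/-- The cycles `y_j` are disjoint, so on the `j`-th column `a` acts as `y_j`. -/
theorem a_apply_of_mem (hs : 0 < s) {j : Fin k} {p : Pt k s n} (hp : p ∈ colList k s n j) :
    a k s n p = y k s n j p := by
  have hdisj : (List.ofFn (y k s n)).Pairwise Equiv.Perm.Disjoint := by
    rw [List.pairwise_ofFn]
    intro j j' hj p
    by_contra! h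
    exact hj.ne (mem_colList_unique (List.mem_of_formPerm_apply_ne h.1)
      (List.mem_of_formPerm_apply_ne h.2))
  refine (Equiv.Perm.eq_on_support_mem_disjoint (List.mem_ofFn.2 ⟨j, rfl⟩) hdisj p ?_).symm
  rw [Equiv.Perm.mem_support, y_eq_formPerm, Ne,
    List.formPerm_apply_mem_eq_self_iff _ (nodup_colList j) _ hp, length_colList]
  omega

theorem a_pow_apply_of_mem (hs : 0 < s) {j : Fin k} {p : Pt k s n} (hp : p ∈ colList k s n j)
    (m : ℕ) : (a k s n ^ m) p = (y k s n j ^ m) p := by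
  induction m generalizing p with
  | zero => rfl
  | succ m ih =>
    rw [pow_succ, pow_succ, Equiv.Perm.mul_apply, Equiv.Perm.mul_apply, a_apply_of_mem hs hp,
      ih (by rwa [y_eq_formPerm, List.formPerm_mem_iff_mem])]

theorem a_pow_apply_getElem (hs : 0 < s) (j : Fin k) (m i : ℕ) (hi : i < (colList k s n j).length) :
    (a k s n ^ m) (colList k s n j)[i] =
      (colList k s n j)[(i + m) % (colList k s n j).length]'(Nat.mod_lt _ (by omega)) := by
  rw [a_pow_apply_of_mem hs (List.getElem_mem hi), y_eq_formPerm,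
    List.formPerm_pow_apply_getElem _ (nodup_colList j)]

theorem colList_getElem_blockPt (j : Fin k) (i : Fin (s + 1)) :
    (colList k s n j)[(i : ℕ)]'(by rw [length_colList]; omega) = blockPt k s n i j := by
  simp only [colList, List.getElem_append, List.length_ofFn, i.2, dif_pos, List.getElem_ofFn]

theorem colList_getElem_tailPt {j : Fin k} (hj : (j : ℕ) = 0) (t : Fin n) :
    (colList k s n j)[s + 1 + (t : ℕ)]'(by rw [length_colList, if_pos hj]; omega) =
      tailPt k s n t := by
  simp [colList, hj, -List.ofFn_succ]

theorem a_apply_getElem (hs : 0 < s) (j : Fin k) (i : ℕ) (hi : i + 1 < (colList k s n j).length) :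
    a k s n ((colList k s n j)[i]'(by omega)) = (colList k s n j)[i + 1] := by
  have h := a_pow_apply_getElem (n := n) hs j 1 i (by omega)
  simp only [pow_one, Nat.mod_eq_of_lt hi] at h
  exact h

theorem a_apply_getElem_last (hs : 0 < s) (j : Fin k) (i : ℕ)
    (hi : i + 1 = (colList k s n j).length) :
    a k s n ((colList k s n j)[i]'(by omega)) = (colList k s n j)[0]'(by omega) := by
  have h := a_pow_apply_getElem (n := n) hs j 1 i (by omega)
  simp only [pow_one, hi, Nat.mod_self] at h
  exact h

theorem a_apply_blockPt (hs : 0 < s) (i : Fin s) (j : Fin k) :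
    a k s n (blockPt k s n i.castSucc j) = blockPt k s n i.succ j := by
  rw [← colList_getElem_blockPt, ← colList_getElem_blockPt]
  exact a_apply_getElem hs j i (by rw [length_colList]; omega)

theorem a_apply_blockPt_last (hs : 0 < s) (j : Fin k) (hj : (j : ℕ) ≠ 0) :
    a k s n (blockPt k s n (Fin.last s) j) = blockPt k s n 0 j := by
  rw [← colList_getElem_blockPt, ← colList_getElem_blockPt]
  exact a_apply_getElem_last hs j s (by rw [length_colList, if_neg hj])

theorem a_apply_blockPt_last_zero (hs : 0 < s) (hn : 0 < n) (j : Fin k) (hj : (j : ℕ) = 0) :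
    a k s n (blockPt k s n (Fin.last s) j) = tailPt k s n ⟨0, hn⟩ := by
  rw [← colList_getElem_blockPt, ← colList_getElem_tailPt hj]
  exact a_apply_getElem hs j s (by rw [length_colList, if_pos hj]; omega)

theorem a_apply_tailPt_last (hs : 0 < s) (hn : 0 < n) (j : Fin k) (hj : (j : ℕ) = 0) :
    a k s n (tailPt k s n ⟨n - 1, by omega⟩) = blockPt k s n 0 j := by
  rw [← colList_getElem_blockPt, ← colList_getElem_tailPt hj]
  exact a_apply_getElem_last hs j _ (by rw [length_colList, if_pos hj]; simp only; omega)

theorem a_pow_succ_apply_blockPt (hs : 0 < s) (i : Fin (s + 1)) (j : Fin k) (hj : (j : ℕ) ≠ 0) :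
    (a k s n ^ (s + 1)) (blockPt k s n i j) = blockPt k s n i j := by
  rw [a_pow_apply_of_mem hs (mem_colList.2 (Or.inl ⟨i, rfl⟩)), y_eq_formPerm]
  have h := List.formPerm_pow_length_eq_one_of_nodup _ (nodup_colList (k := k) (s := s) (n := n) j)
  rw [length_colList, if_neg hj, add_zero] at h
  rw [h, Equiv.Perm.one_apply]

/-- As `s + 1` is coprime to the length `s + 1 + n` of the column of index `0`, the power
`a ^ (s + 1)` still permutes that column in a single cycle. -/
theorem exists_a_pow_succ_pow_apply_eq (hs : 0 < s) (hc : Nat.gcd n (s + 1) = 1)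
    {j : Fin k} (hj : (j : ℕ) = 0) {p q : Pt k s n} (hp : p ∈ colList k s n j)
    (hq : q ∈ colList k s n j) : ∃ m : ℕ, ((a k s n ^ (s + 1)) ^ m) p = q := by
  obtain ⟨i, hi, rfl⟩ := List.getElem_of_mem hp
  obtain ⟨i', hi', rfl⟩ := List.getElem_of_mem hq
  have hlen : (colList k s n j).length = s + 1 + n := by rw [length_colList, if_pos hj]
  have hcop : Nat.Coprime (s + 1) (colList k s n j).length := by
    rw [hlen, Nat.coprime_self_add_right]
    exact Nat.Coprime.symm hc
  obtain ⟨c, -, hc⟩ := Nat.exists_mul_mod_eq_of_coprime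
    (i' + ((colList k s n j).length - i)) hcop (by omega)
  refine ⟨c, ?_⟩
  rw [← pow_mul, a_pow_apply_getElem hs]
  congr 1
  rw [Nat.add_mod, hc, ← Nat.add_mod, show i + (i' + ((colList k s n j).length - i)) =
    i' + (colList k s n j).length by omega, Nat.add_mod_right, Nat.mod_eq_of_lt hi']

/-! ### Conjugation by `a` -/

theorem a_mul_x_mul_inv (hs : 0 < s) (i : Fin s) :
    a k s n * x k s n i.castSucc * (a k s n)⁻¹ = x k s n i.succ := by
  rw [x_eq_formPerm, List.conj_formPerm, x_eq_formPerm, rowList, List.map_ofFn]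
  congr 2
  funext j
  exact a_apply_blockPt hs i j

/-- The `k`-cycles `x_0` and `a x_s a⁻¹` differ only in that the point `0` is replaced by the first
tail point, so that their quotient is a product of two swaps with one common point. -/
theorem isThreeCycle_x_mul (hk : 2 ≤ k) (hs : 0 < s) (hn : 0 < n) :
    (x k s n 0 * (a k s n * x k s n (Fin.last s) * (a k s n)⁻¹)⁻¹).IsThreeCycle := by
  obtain ⟨k, rfl⟩ := Nat.exists_eq_add_of_le' hk
  have h1 : rowList (k + 2) s n 0 = blockPt (k + 2) s n 0 0 :: blockPt (k + 2) s n 0 1 ::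
      List.ofFn fun j : Fin k => blockPt (k + 2) s n 0 j.succ.succ := by
    simp [rowList, List.ofFn_succ]
  have h2 : (rowList (k + 2) s n (Fin.last s)).map (a (k + 2) s n) = tailPt (k + 2) s n ⟨0, hn⟩ ::
      blockPt (k + 2) s n 0 1 ::
      List.ofFn fun j : Fin k => blockPt (k + 2) s n 0 j.succ.succ := by
    rw [rowList, List.map_ofFn, List.ofFn_succ, List.ofFn_succ]
    simp only [Function.comp_apply]
    rw [a_apply_blockPt_last_zero hs hn 0 rfl, a_apply_blockPt_last hs _ (by simp)]
    congr 3
    funext j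
    exact a_apply_blockPt_last hs _ (by simp)
  rw [x_eq_formPerm (Fin.last s), List.conj_formPerm, h2, x_eq_formPerm, h1,
    List.formPerm_cons_cons, List.formPerm_cons_cons, mul_inv_rev, mul_assoc, mul_inv_cancel_left,
    Equiv.swap_inv, Equiv.swap_comm, Equiv.swap_comm (tailPt _ _ _ _)]
  refine Equiv.Perm.isThreeCycle_swap_mul_swap_same ?_ ?_ ?_
  · rw [Ne, blockPt_inj]
    simp
  · exact blockPt_ne_tailPt _ _ _
  · exact blockPt_ne_tailPt _ _ _

/-! ### The groups `H` and `X` on the points -/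

theorem x_mem_H (i : Fin (s + 1)) : x k s n i ∈ H k s n :=
  Subgroup.subset_closure ⟨i, rfl⟩

theorem H_le_X : H k s n ≤ X k s n := le_sup_left

theorem x_mem_X (i : Fin (s + 1)) : x k s n i ∈ X k s n := H_le_X (x_mem_H i)

theorem apply_tailPt_of_mem_H {h : Equiv.Perm (Pt k s n)} (hh : h ∈ H k s n) (t : Fin n) :
    h (tailPt k s n t) = tailPt k s n t := by
  have : H k s n ≤ MulAction.stabilizer (Equiv.Perm (Pt k s n)) (tailPt k s n t) := by
    rw [H, Subgroup.closure_le]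
    rintro _ ⟨i, rfl⟩
    exact x_apply_tailPt i t
  exact this hh

theorem commute_x_of_mem_H {h : Equiv.Perm (Pt k s n)} (hh : h ∈ H k s n) (i : Fin (s + 1)) :
    Commute h (x k s n i) := by
  have : H k s n ≤ Subgroup.centralizer {x k s n i} := by
    rw [H, Subgroup.closure_le]
    rintro _ ⟨i', rfl⟩
    rw [SetLike.mem_coe, Subgroup.mem_centralizer_singleton_iff]
    exact x_commute i' i
  exact Subgroup.mem_centralizer_singleton_iff.1 (this hh)

open scoped Pointwise in
theorem exists_apply_blockPt_of_mem_H {h : Equiv.Perm (Pt k s n)} (hh : h ∈ H k s n)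
    (i : Fin (s + 1)) (j : Fin k) : ∃ j', h (blockPt k s n i j) = blockPt k s n i j' := by
  have hle : H k s n ≤ MulAction.stabilizer (Equiv.Perm (Pt k s n))
      {p | p ∈ rowList k s n i} := by
    rw [H, Subgroup.closure_le]
    rintro _ ⟨i', rfl⟩
    rw [SetLike.mem_coe, MulAction.mem_stabilizer_set]
    intro p
    change x k s n i' p ∈ rowList k s n i ↔ p ∈ rowList k s n i
    by_cases hi : i' = i
    · rw [hi, x_eq_formPerm, List.formPerm_mem_iff_mem]
    by_cases hp : p ∈ rowList k s n i'
    · have hp' : x k s n i' p ∈ rowList k s n i' := List.formPerm_mem_iff_mem.2 hp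
      obtain ⟨j₁, h₁⟩ := mem_rowList.1 hp
      obtain ⟨j₂, h₂⟩ := mem_rowList.1 hp'
      rw [← h₂, ← h₁, mem_rowList, mem_rowList]
      simp only [blockPt_inj, Ne.symm hi, false_and, exists_false]
    · rw [x_eq_formPerm, List.formPerm_apply_of_notMem hp]
  have h := (MulAction.mem_stabilizer_set.1 (hle hh) (blockPt k s n i j)).2
    (mem_rowList.2 ⟨j, rfl⟩)
  obtain ⟨j', hj'⟩ := mem_rowList.1 h
  exact ⟨j', hj'.symm⟩

theorem isPretransitive_X (hk : 2 ≤ k) (hs : 0 < s) :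
    MulAction.IsPretransitive (X k s n) (Pt k s n) := by
  let z : Fin k := ⟨0, by omega⟩
  have hcol : ∀ p ∈ colList k s n z, ∃ g : X k s n, g • blockPt k s n 0 z = p := by
    intro p hp
    obtain ⟨i, hi, rfl⟩ := List.getElem_of_mem hp
    refine ⟨⟨a k s n ^ i, pow_mem (a_mem_X k s n) i⟩, ?_⟩
    change (a k s n ^ i) (blockPt k s n 0 z) = _
    rw [← colList_getElem_blockPt, a_pow_apply_getElem hs]
    congr 1
    simp [Nat.mod_eq_of_lt hi]
  refine (MulAction.isPretransitive_iff_base (blockPt k s n 0 z)).2 fun p => ?_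
  rcases exists_eq_blockPt_or_tailPt p with ⟨i, j, rfl⟩ | ⟨t, rfl⟩
  · obtain ⟨g, hg⟩ := hcol (blockPt k s n i z) (mem_colList.2 (Or.inl ⟨i, rfl⟩))
    refine ⟨⟨x k s n i ^ (j : ℕ), pow_mem (x_mem_X i) j⟩ * g, ?_⟩
    rw [mul_smul, hg]
    change (x k s n i ^ (j : ℕ)) (blockPt k s n i z) = _
    rw [x_pow_apply_blockPt]
    congr 1
    exact Fin.ext (by simp [z, Nat.mod_eq_of_lt j.2])
  · exact hcol _ (mem_colList.2 (Or.inr ⟨rfl, t, rfl⟩))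

end CLP

namespace CLP

variable {k s n : ℕ}

/-! ### The action on points is primitive -/

section Primitive

open scoped Pointwise

theorem apply_mem_of_isBlock {B : Set (Pt k s n)} (hB : MulAction.IsBlock (X k s n) B)
    {g : Equiv.Perm (Pt k s n)} (hg : g ∈ X k s n) {p q : Pt k s n} (hp : p ∈ B) (hgp : g p = p)
    (hq : q ∈ B) : g q ∈ B := by
  have h : (⟨g, hg⟩ : X k s n) • B = B :=
    MulAction.isBlock_iff_smul_eq_of_mem.1 hB hp (by change g p ∈ B; rwa [hgp])
  rw [← h]
  exact Set.smul_mem_smul_set (a := (⟨g, hg⟩ : X k s n)) hq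

/-- A block with points both inside and outside the column of index `0` is everything: a power of
`a` fixing the outer point cycles through the column, and then every row cycle fixes a tail point
of the block. -/
theorem isBlock_eq_univ (hs : 0 < s) (hn : 0 < n) (hc : Nat.gcd n (s + 1) = 1)
    {B : Set (Pt k s n)} (hB : MulAction.IsBlock (X k s n) B) {z : Fin k} (hz : (z : ℕ) = 0)
    {i : Fin (s + 1)} {j : Fin k} (hj : (j : ℕ) ≠ 0) (hp : blockPt k s n i j ∈ B)
    {q : Pt k s n} (hq : q ∈ colList k s n z) (hqB : q ∈ B) : B = Set.univ := by
  have hcol : ∀ q' ∈ colList k s n z, q' ∈ B := by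
    intro q' hq'
    obtain ⟨m, rfl⟩ := exists_a_pow_succ_pow_apply_eq hs hc hz hq hq'
    refine apply_mem_of_isBlock hB (pow_mem (pow_mem (a_mem_X k s n) _) m) hp ?_ hqB
    exact Equiv.Perm.pow_apply_eq_self_of_apply_eq_self (a_pow_succ_apply_blockPt hs i j hj) m
  have htail : ∀ t, tailPt k s n t ∈ B := fun t => hcol _ (mem_colList.2 (Or.inr ⟨hz, t, rfl⟩))
  refine Set.eq_univ_of_forall fun p => ?_
  rcases exists_eq_blockPt_or_tailPt p with ⟨i', j', rfl⟩ | ⟨t, rfl⟩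
  · have h := apply_mem_of_isBlock hB (pow_mem (x_mem_X i') (j' : ℕ)) (htail ⟨0, hn⟩)
      (apply_tailPt_of_mem_H (pow_mem (x_mem_H i') _) _)
      (hcol (blockPt k s n i' z) (mem_colList.2 (Or.inl ⟨i', rfl⟩)))
    rw [x_pow_apply_blockPt] at h
    convert h
    simp [hz, Nat.mod_eq_of_lt j'.2]
  · exact htail t

theorem isPreprimitive_X (hk : 2 ≤ k) (hs : 0 < s) (hn : 0 < n) (hc : Nat.gcd n (s + 1) = 1) :
    MulAction.IsPreprimitive (X k s n) (Pt k s n) := by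
  have := isPretransitive_X (n := n) hk hs
  let z : Fin k := ⟨0, by omega⟩
  let o : Fin k := ⟨1, by omega⟩
  refine MulAction.IsPreprimitive.of_isTrivialBlock_base (blockPt k s n 0 o) fun {B} ho hB => ?_
  by_cases hsub : B.Subsingleton
  · exact Or.inl hsub
  right
  obtain ⟨q, hqB, hqo⟩ : ∃ q ∈ B, q ≠ blockPt k s n 0 o := by
    by_contra! h
    exact hsub fun p hp q hq => (h p hp).trans (h q hq).symm
  by_cases hq : q ∈ colList k s n z
  · exact isBlock_eq_univ hs hn hc hB rfl (j := o) one_ne_zero ho hq hqB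
  rcases exists_eq_blockPt_or_tailPt q with ⟨i, j, rfl⟩ | ⟨t, rfl⟩
  · -- Rotate the row of `q` so that `q` arrives in the column of index `0`; the base point does not.
    let g : X k s n := ⟨x k s n i ^ (k - j), pow_mem (x_mem_X i) _⟩
    have hgB : MulAction.IsBlock (X k s n) (g • B) := hB.translate g
    have hgq : blockPt k s n i z ∈ g • B := by
      have h : g • blockPt k s n i j ∈ g • B := Set.smul_mem_smul_set hqB
      change (x k s n i ^ (k - (j : ℕ))) (blockPt k s n i j) ∈ g • B at h
      rw [x_pow_apply_blockPt] at h
      convert h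
      simp [Nat.add_sub_of_le j.2.le]
    have hgo : ∃ (i' : Fin (s + 1)) (j' : Fin k), (j' : ℕ) ≠ 0 ∧ blockPt k s n i' j' ∈ g • B := by
      have h : g • blockPt k s n 0 o ∈ g • B := Set.smul_mem_smul_set ho
      change (x k s n i ^ (k - (j : ℕ))) (blockPt k s n 0 o) ∈ g • B at h
      by_cases hi : i = 0
      · subst hi
        rw [x_pow_apply_blockPt] at h
        refine ⟨_, _, ?_, h⟩
        have hj0 : (j : ℕ) ≠ 0 := fun h0 =>
          hq (mem_colList.2 (Or.inl ⟨0, by rw [blockPt_inj]; exact ⟨rfl, Fin.ext h0.symm⟩⟩))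
        have hj1 : (j : ℕ) ≠ 1 := fun h1 => hqo (by rw [blockPt_inj]; exact ⟨rfl, Fin.ext h1⟩)
        have := j.2
        change (1 + (k - (j : ℕ))) % k ≠ 0
        rw [Nat.mod_eq_of_lt (by omega)]
        omega
      · have hfix : (x k s n i ^ (k - (j : ℕ))) (blockPt k s n 0 o) = blockPt k s n 0 o :=
          Equiv.Perm.pow_apply_eq_self_of_apply_eq_self (x_apply_blockPt_of_ne hi o) _
        rw [hfix] at h
        exact ⟨0, o, one_ne_zero, h⟩
    obtain ⟨i', j', hj', hmem⟩ := hgo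
    have huniv := isBlock_eq_univ hs hn hc hgB (z := z) rfl hj' hmem
      (mem_colList.2 (Or.inl ⟨i, rfl⟩)) hgq
    rwa [Set.smul_set_eq_univ] at huniv
  · exact absurd (mem_colList.2 (Or.inr ⟨rfl, t, rfl⟩)) hq

end Primitive

/-! ### The group `X` and its normal subgroups -/

theorem alternatingGroup_le_X (hk : 2 ≤ k) (hs : 0 < s) (hn : 0 < n)
    (hc : Nat.gcd n (s + 1) = 1) : alternatingGroup (Pt k s n) ≤ X k s n :=
  Equiv.Perm.alternatingGroup_le_of_isPreprimitive_of_isThreeCycle_mem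
    (isPreprimitive_X hk hs hn hc) (isThreeCycle_x_mul hk hs hn)
    (mul_mem (x_mem_X _) (inv_mem (mul_mem (mul_mem (a_mem_X k s n) (x_mem_X _))
      (inv_mem (a_mem_X k s n)))))

theorem X_eq_top (hk : 2 ≤ k) (hs : 0 < s) (hn : 0 < n) (hc : Nat.gcd n (s + 1) = 1)
    {g : Equiv.Perm (Pt k s n)} (hg : g ∈ X k s n) (hsign : Equiv.Perm.sign g = -1) :
    X k s n = ⊤ := by
  refine (Subgroup.eq_top_iff' _).2 fun f => ?_
  rcases Int.units_eq_one_or (Equiv.Perm.sign f) with hf | hf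
  · exact alternatingGroup_le_X hk hs hn hc hf
  · have h : f * g⁻¹ ∈ X k s n := alternatingGroup_le_X hk hs hn hc
      (Equiv.Perm.mem_alternatingGroup.2 (by simp [hf, hsign]))
    simpa using mul_mem h hg

theorem X_eq_alternatingGroup (hk : 2 ≤ k) (hs : 0 < s) (hn : 0 < n) (hc : Nat.gcd n (s + 1) = 1)
    (hx : ∀ i, Equiv.Perm.sign (x k s n i) = 1) (ha : Equiv.Perm.sign (a k s n) = 1) :
    X k s n = alternatingGroup (Pt k s n) := by
  refine le_antisymm (sup_le ?_ ?_) (alternatingGroup_le_X hk hs hn hc)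
  · rw [H, Subgroup.closure_le]
    rintro _ ⟨i, rfl⟩
    exact hx i
  · rw [Subgroup.closure_le, Set.singleton_subset_iff]
    exact ha

theorem five_le_card (hk : 2 ≤ k) (hs : 0 < s) (hn : 0 < n) : 5 ≤ Nat.card (Pt k s n) := by
  rw [Nat.card_fin]
  have : 2 * 2 ≤ (s + 1) * k := Nat.mul_le_mul (by omega) hk
  omega

/-- Since `X` is the alternating or the symmetric group, each of its nontrivial normal subgroups
contains all even permutations. -/
theorem mem_of_normal (hk : 2 ≤ k) (hs : 0 < s) (hn : 0 < n) (hc : Nat.gcd n (s + 1) = 1)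
    {N : Subgroup (X k s n)} (hN : N.Normal) (hne : N ≠ ⊥) {g : X k s n}
    (hg : Equiv.Perm.sign (g : Equiv.Perm (Pt k s n)) = 1) : g ∈ N := by
  have h5 := five_le_card hk hs hn
  by_cases hX : ∃ f ∈ X k s n, Equiv.Perm.sign f = -1
  · obtain ⟨f, hf, hsign⟩ := hX
    have htop := X_eq_top hk hs hn hc hf hsign
    have hnorm : (N.map (X k s n).subtype).Normal := by
      refine hN.map _ fun p => ⟨⟨p, htop ▸ Subgroup.mem_top p⟩, rfl⟩
    have hnt : Nontrivial (N.map (X k s n).subtype) := by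
      rw [Subgroup.nontrivial_iff_ne_bot, Ne, Subgroup.map_eq_bot_iff_of_injective _
        (Subgroup.subtype_injective _)]
      exact hne
    obtain ⟨m, hm, hmg⟩ := Equiv.Perm.alternatingGroup_le_of_normal h5 hnt
      (Equiv.Perm.mem_alternatingGroup.2 hg)
    rwa [← Subtype.ext hmg]
  · have hX' : ∀ f ∈ X k s n, Equiv.Perm.sign f = 1 := fun f hf =>
      (Int.units_eq_one_or _).resolve_right fun h => hX ⟨f, hf, h⟩
    let e : alternatingGroup (Pt k s n) →* X k s n :=
      Subgroup.inclusion (alternatingGroup_le_X hk hs hn hc)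
    have hbot := alternatingGroup.normal_subgroup_eq_bot_or_eq_top h5 (N := N.comap e)
    rcases hbot with h | h
    · refine absurd ((Subgroup.eq_bot_iff_forall _).2 fun f hf => ?_) hne
      have hf' : (⟨f, hX' f f.2⟩ : alternatingGroup (Pt k s n)) ∈ N.comap e := hf
      rw [h, Subgroup.mem_bot] at hf'
      exact Subtype.ext (congrArg
        (fun f : alternatingGroup (Pt k s n) => (f : Equiv.Perm (Pt k s n))) hf')
    · have hg' : (⟨g, hg⟩ : alternatingGroup (Pt k s n)) ∈ N.comap e := h ▸ Subgroup.mem_top _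
      exact hg'

end CLP

/-! ### Coset digraphs -/

/-- The coset digraph of a group `G` with respect to a subgroup `H` and an element `a`: its vertices
are the cosets of `H`, and its arcs are the pairs `(g H, g a H)`. -/
def cosetDigraph {G : Type*} [Group G] (H : Subgroup G) (a : G) : Digraph (G ⧸ H) where
  Adj u v := ∃ g : G, u = QuotientGroup.mk g ∧ v = QuotientGroup.mk (g * a)

namespace cosetDigraph

variable {G : Type*} [Group G] {H : Subgroup G} {a : G}

theorem adj_mk_mul (H : Subgroup G) (a g : G) :
    (cosetDigraph H a).Adj (QuotientGroup.mk g) (QuotientGroup.mk (g * a)) :=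
  ⟨g, rfl, rfl⟩

theorem adj_mk_left {g : G} {v : G ⧸ H} :
    (cosetDigraph H a).Adj (QuotientGroup.mk g) v ↔ ∃ h ∈ H, v = QuotientGroup.mk (g * h * a) := by
  constructor
  · rintro ⟨g', hg, rfl⟩
    exact ⟨g⁻¹ * g', QuotientGroup.eq.1 hg, by rw [mul_inv_cancel_left]⟩
  · rintro ⟨h, hh, rfl⟩
    exact ⟨g * h, QuotientGroup.eq.2 (by simpa using hh), rfl⟩

theorem adj_mk_right {g : G} {v : G ⧸ H} :
    (cosetDigraph H a).Adj v (QuotientGroup.mk g) ↔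
      ∃ h ∈ H, v = QuotientGroup.mk (g * h * a⁻¹) := by
  constructor
  · rintro ⟨g', rfl, hg⟩
    refine ⟨g⁻¹ * (g' * a), QuotientGroup.eq.1 hg, ?_⟩
    congr 1
    group
  · rintro ⟨h, hh, rfl⟩
    exact ⟨g * h * a⁻¹, rfl, QuotientGroup.eq.2 (by simpa using hh)⟩

theorem smul_adj_smul_iff (g : G) (u v : G ⧸ H) :
    (cosetDigraph H a).Adj (g • u) (g • v) ↔ (cosetDigraph H a).Adj u v := by
  have key : ∀ (g : G) (u v : G ⧸ H), (cosetDigraph H a).Adj u v →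
      (cosetDigraph H a).Adj (g • u) (g • v) := by
    rintro g _ _ ⟨g', rfl, rfl⟩
    exact ⟨g * g', rfl, congrArg QuotientGroup.mk (mul_assoc g g' a).symm⟩
  refine ⟨fun h => ?_, key g u v⟩
  simpa using key g⁻¹ _ _ h

theorem isAsymm (h : ∀ h ∈ H, a * h * a ∉ H) : (cosetDigraph H a).IsAsymm := by
  rintro _ _ ⟨g, rfl, rfl⟩ hadj
  obtain ⟨h', hh', heq⟩ := adj_mk_left.1 hadj
  apply h h' hh'
  have := QuotientGroup.eq.1 heq
  rwa [mul_assoc, mul_assoc, inv_mul_cancel_left, ← mul_assoc] at this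

theorem connected (ha : ∀ h ∈ H, a * h * a ∉ H) (hgen : H ⊔ Subgroup.closure {a} = ⊤) :
    (cosetDigraph H a).toSimpleGraphInclusive.Connected := by
  -- The elements by which right multiplication preserves all connected components form a subgroup.
  let K : Subgroup G :=
    { carrier := {w | ∀ g : G, (cosetDigraph H a).toSimpleGraphInclusive.Reachable
        (QuotientGroup.mk g) (QuotientGroup.mk (g * w))}
      one_mem' := fun g => by rw [mul_one]
      mul_mem' := fun {w w'} hw hw' g => by
        rw [← mul_assoc]
        exact (hw g).trans (hw' (g * w))
      inv_mem' := fun {w} hw g => by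
        have h := hw (g * w⁻¹)
        rw [inv_mul_cancel_right] at h
        exact h.symm }
  have hK : K = ⊤ := by
    rw [eq_top_iff, ← hgen]
    refine sup_le (fun h hh g => ?_) ?_
    · rw [QuotientGroup.mk_mul_of_mem g hh]
    · rw [Subgroup.closure_le, Set.singleton_subset_iff]
      intro g
      refine SimpleGraph.Adj.reachable ⟨fun heq => ?_, Or.inl (adj_mk_mul H a g)⟩
      have hadj := adj_mk_mul H a g
      rw [← heq] at hadj
      exact isAsymm ha _ _ hadj hadj
  have : Nonempty (G ⧸ H) := ⟨QuotientGroup.mk 1⟩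
  refine SimpleGraph.Connected.mk fun u v => ?_
  obtain ⟨g, rfl⟩ := QuotientGroup.mk_surjective u
  obtain ⟨g', rfl⟩ := QuotientGroup.mk_surjective v
  have h : g⁻¹ * g' ∈ K := hK ▸ Subgroup.mem_top _
  have := h g
  rwa [mul_inv_cancel_left] at this

/-- If every arc from the base vertex ends in `c 0 ^ m a H` for some `m`, and `c 0, …, c (s - 1)` are
elements of `H` with `a (c t) a⁻¹ = c (t + 1)`, then the powers of `c t` fix the `t`-arc
`(H, a H, …, a ^ t H)` and permute its extensions transitively. -/
theorem isSArcTransitive {s : ℕ} (c : ℕ → G) (hc : ∀ t < s, c t ∈ H)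
    (hca : ∀ t, t + 1 < s → c (t + 1) * a = a * c t)
    (hH : ∀ h ∈ H, ∃ m : ℤ, ∃ h' ∈ H, h * a = c 0 ^ m * a * h') :
    (cosetDigraph H a).IsSArcTransitive G s := by
  have hcomm : ∀ i j (m : ℤ), i + j < s → c (i + j) ^ m * a ^ i = a ^ i * c j ^ m := by
    intro i j m
    induction i with
    | zero => simp
    | succ i ih =>
      intro hlt
      have h1 : SemiconjBy a (c (i + j)) (c (i + 1 + j)) := by
        have := hca (i + j) (by omega)
        rw [show i + 1 + j = i + j + 1 by omega]
        exact this.symm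
      rw [pow_succ', ← mul_assoc, ← (h1.zpow_right m).eq, mul_assoc, ih (by omega), mul_assoc]
  have key : ∀ t ≤ s, ∀ p : ℕ → G ⧸ H, (∀ i < t, (cosetDigraph H a).Adj (p i) (p (i + 1))) →
      ∃ g : G, ∀ i ≤ t, p i = QuotientGroup.mk (g * a ^ i) := by
    intro t
    induction t with
    | zero =>
      intro _ p _
      obtain ⟨g, hg⟩ := QuotientGroup.mk_surjective (p 0)
      exact ⟨g, fun i hi => by rw [Nat.le_zero.1 hi, pow_zero, mul_one, hg]⟩
    | succ t ih =>
      intro ht p hp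
      obtain ⟨g, hg⟩ := ih (by omega) p fun i hi => hp i (by omega)
      have hadj := hp t (by omega)
      rw [hg t le_rfl] at hadj
      obtain ⟨h, hh, hlast⟩ := adj_mk_left.1 hadj
      obtain ⟨m, h', hh', heq⟩ := hH h hh
      refine ⟨g * c t ^ m, fun i hi => ?_⟩
      rcases Nat.lt_or_ge i (t + 1) with hit | hit
      · obtain ⟨j, rfl⟩ := Nat.exists_eq_add_of_le (Nat.lt_succ_iff.1 hit)
        rw [hg i (by omega), mul_assoc, hcomm i j m (by omega), ← mul_assoc,
          QuotientGroup.mk_mul_of_mem _ (zpow_mem (hc j (by omega)) m)]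
      · obtain rfl : i = t + 1 := by omega
        have h0 := hcomm t 0 m (by omega)
        rw [add_zero] at h0
        rw [hlast, mul_assoc, heq, ← mul_assoc, QuotientGroup.mk_mul_of_mem _ hh', pow_succ,
          mul_assoc g (c t ^ m), ← mul_assoc (c t ^ m), h0]
        simp only [mul_assoc]
  have hstd : ∀ p : (cosetDigraph H a).SArc s, ∃ g : G, ∀ i : Fin (s + 1),
      p.1 i = QuotientGroup.mk (g * a ^ (i : ℕ)) := by
    intro p
    have hofNat : ∀ (i : ℕ) (hi : i < s + 1), Fin.ofNat (s + 1) i = ⟨i, hi⟩ := fun i hi =>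
      Fin.ext (Nat.mod_eq_of_lt hi)
    obtain ⟨g, hg⟩ := key s le_rfl (fun i => p.1 (Fin.ofNat (s + 1) i)) fun i hi => by
      rw [hofNat i (by omega), hofNat (i + 1) (by omega)]
      exact p.2 ⟨i, hi⟩
    refine ⟨g, fun i => ?_⟩
    rw [← hg i (by omega), hofNat i i.2]
  intro p q
  obtain ⟨g, hg⟩ := hstd p
  obtain ⟨g', hg'⟩ := hstd q
  refine ⟨g' * g⁻¹, fun i => ?_⟩
  rw [hg, hg']
  change (QuotientGroup.mk (g' * g⁻¹ * (g * a ^ (i : ℕ))) : G ⧸ H) = _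
  rw [← mul_assoc, inv_mul_cancel_right]

/-- The cosets `g h b H` with `h ∈ H`, where `b` is `a` or `a⁻¹`, are counted by a cyclic complement
of `H ∩ b H b⁻¹` in `H`. -/
theorem encard_setOf_mk_mul [Finite G] {b c : G} (hcH : c ∈ H)
    (hH : ∀ h ∈ H, ∃ m : ℤ, ∃ h' ∈ H, h * b = c ^ m * b * h')
    (hc : ∀ m : ℤ, b⁻¹ * c ^ m * b ∈ H → c ^ m = 1) (g : G) :
    {v : G ⧸ H | ∃ h ∈ H, v = QuotientGroup.mk (g * h * b)}.encard = orderOf c := by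
  have hrange : {v : G ⧸ H | ∃ h ∈ H, v = QuotientGroup.mk (g * h * b)} =
      Set.range fun z : Subgroup.zpowers c => (QuotientGroup.mk (g * z * b) : G ⧸ H) := by
    ext v
    constructor
    · rintro ⟨h, hh, rfl⟩
      obtain ⟨m, h', hh', heq⟩ := hH h hh
      refine ⟨⟨c ^ m, m, rfl⟩, ?_⟩
      rw [mul_assoc g h, heq, ← mul_assoc, QuotientGroup.mk_mul_of_mem _ hh', ← mul_assoc]
    · rintro ⟨⟨_, m, rfl⟩, rfl⟩
      exact ⟨c ^ m, zpow_mem hcH m, rfl⟩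
  have hinj : Function.Injective
      fun z : Subgroup.zpowers c => (QuotientGroup.mk (g * z * b) : G ⧸ H) := by
    rintro ⟨_, m, rfl⟩ ⟨_, m', rfl⟩ heq
    have h := QuotientGroup.eq.1 heq
    have h1 : b⁻¹ * c ^ (-m + m') * b ∈ H := by
      rw [zpow_add, zpow_neg]
      simpa [mul_assoc] using h
    have h2 := hc _ h1
    rw [zpow_add, zpow_neg, inv_mul_eq_one] at h2
    exact Subtype.ext h2
  rw [hrange, ← Set.image_univ, hinj.encard_image, Set.encard_univ, ENat.card_eq_coe_natCard,
    Nat.card_zpowers]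

theorem not_isBipartite (ha : ∀ h ∈ H, a * h * a ∉ H) (hgen : H ⊔ Subgroup.closure {a} = ⊤)
    (hsq : ∃ t : G, t * t ≠ 1) (hq : IsQuasiprimitiveAction G (G ⧸ H)) :
    ¬ (cosetDigraph H a).toSimpleGraphInclusive.IsBipartite := by
  rintro ⟨C⟩
  have hCa : ∀ g : G, C (QuotientGroup.mk (g * a)) ≠ C (QuotientGroup.mk g) := fun g =>
    Ne.symm (C.valid ⟨fun heq => by
      have hadj := adj_mk_mul H a g
      rw [← heq] at hadj
      exact isAsymm ha _ _ hadj hadj, Or.inl (adj_mk_mul H a g)⟩)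
  -- Right multiplication by any element either preserves or reverses the colouring.
  let W : Subgroup G :=
    { carrier := {w | ∃ e : Equiv.Perm (Fin 2), ∀ g : G,
        C (QuotientGroup.mk (g * w)) = e (C (QuotientGroup.mk g))}
      one_mem' := ⟨1, fun g => by rw [mul_one, Equiv.Perm.one_apply]⟩
      mul_mem' := by
        rintro w w' ⟨e, he⟩ ⟨e', he'⟩
        exact ⟨e' * e, fun g => by rw [← mul_assoc, he', he, Equiv.Perm.mul_apply]⟩
      inv_mem' := by
        rintro w ⟨e, he⟩
        refine ⟨e⁻¹, fun g => ?_⟩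
        rw [Equiv.Perm.eq_inv_iff_eq, ← he, inv_mul_cancel_right] }
  have hW : W = ⊤ := by
    rw [eq_top_iff, ← hgen]
    refine sup_le (fun h hh => ⟨1, fun g => ?_⟩) ?_
    · rw [QuotientGroup.mk_mul_of_mem g hh, Equiv.Perm.one_apply]
    · rw [Subgroup.closure_le, Set.singleton_subset_iff]
      refine ⟨Equiv.swap 0 1, fun g => ?_⟩
      have := hCa g
      generalize C (QuotientGroup.mk (g * a)) = c at this ⊢
      generalize C (QuotientGroup.mk g) = d at this ⊢
      revert c d
      decide
  let N : Subgroup G :=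
    { carrier := {w | ∀ g : G, C (QuotientGroup.mk (g * w)) = C (QuotientGroup.mk g)}
      one_mem' := fun g => by rw [mul_one]
      mul_mem' := fun {w w'} hw hw' g => by rw [← mul_assoc, hw', hw]
      inv_mem' := fun {w} hw g => by rw [← hw (g * w⁻¹), inv_mul_cancel_right] }
  have hN : N.Normal := by
    refine ⟨fun w hw u g => ?_⟩
    obtain ⟨e, he⟩ : u ∈ W := hW ▸ Subgroup.mem_top u
    apply e.injective
    rw [← he, ← he, show g * (u * w * u⁻¹) * u = g * u * w by group, hw]
  have hne : N ≠ ⊥ := by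
    obtain ⟨t, ht⟩ := hsq
    intro hbot
    apply ht
    rw [← Subgroup.mem_bot, ← hbot]
    obtain ⟨e, he⟩ : t ∈ W := hW ▸ Subgroup.mem_top t
    intro g
    rw [← mul_assoc, he, he]
    exact (show ∀ (e : Equiv.Perm (Fin 2)) (d : Fin 2), e (e d) = d by decide) e _
  obtain ⟨⟨w, hw⟩, hwa⟩ := (hq N hN hne).exists_smul_eq (QuotientGroup.mk 1 : G ⧸ H)
    (QuotientGroup.mk a)
  have hwa' : (QuotientGroup.mk (w * 1) : G ⧸ H) = QuotientGroup.mk a := hwa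
  apply hCa 1
  rw [one_mul, ← hwa', mul_one]
  simpa using hw 1

end cosetDigraph

/-- Let `H` be generated by elements commuting with one of them, `x i₀`, such that `b` conjugates
all the other ones into `H`. Then `H b H` is the union of the cosets `x i₀ ^ m b H`. -/
theorem Subgroup.exists_mul_eq_zpow_mul_mul {G ι : Type*} [Group G] {x : ι → G} {i₀ : ι} {b : G}
    (hcomm : ∀ h ∈ Subgroup.closure (Set.range x), Commute h (x i₀))
    (hb : ∀ i, i ≠ i₀ → b⁻¹ * x i * b ∈ Subgroup.closure (Set.range x)) {h : G}
    (hh : h ∈ Subgroup.closure (Set.range x)) :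
    ∃ m : ℤ, ∃ h' ∈ Subgroup.closure (Set.range x), h * b = x i₀ ^ m * b * h' := by
  induction hh using Subgroup.closure_induction with
  | mem h hh =>
    obtain ⟨i, rfl⟩ := hh
    by_cases hi : i = i₀
    · exact ⟨1, 1, one_mem _, by rw [hi, zpow_one, mul_one]⟩
    · exact ⟨0, _, hb i hi, by group⟩
  | one => exact ⟨0, 1, one_mem _, by simp⟩
  | mul h₁ h₂ hh₁ hh₂ ih₁ ih₂ =>
    obtain ⟨m₁, h₁', hh₁', e₁⟩ := ih₁
    obtain ⟨m₂, h₂', hh₂', e₂⟩ := ih₂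
    refine ⟨m₂ + m₁, h₁' * h₂', mul_mem hh₁' hh₂', ?_⟩
    calc h₁ * h₂ * b = h₁ * x i₀ ^ m₂ * b * h₂' := by rw [mul_assoc, e₂]; simp only [mul_assoc]
      _ = x i₀ ^ m₂ * (h₁ * b) * h₂' := by
        rw [((hcomm h₁ hh₁).zpow_right m₂).eq]; simp only [mul_assoc]
      _ = _ := by rw [e₁, zpow_add]; simp only [mul_assoc]
  | inv h hh ih =>
    obtain ⟨m, h', hh', e⟩ := ih
    refine ⟨-m, h'⁻¹, inv_mem hh', ?_⟩
    have hc := ((hcomm h hh).inv_left.zpow_right (-m)).eq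
    calc h⁻¹ * b = h⁻¹ * x i₀ ^ (-m) * (x i₀ ^ m * b * h') * h'⁻¹ := by group
      _ = x i₀ ^ (-m) * b * h'⁻¹ := by rw [← e, hc]; group

/-! ### Normal quotients -/

theorem IsQuasiprimitiveAction.card_le {G V : Type*} [Group G] [MulAction G V]
    (h : IsQuasiprimitiveAction G V) (N : Subgroup G) (hN : N.Normal) (hne : N ≠ ⊥) :
    ENat.card (MulAction.orbitRel.Quotient N V) ≤ 1 := by
  have := h N hN hne
  rw [ENat.card_le_one_iff_subsingleton]
  exact (MulAction.pretransitive_iff_subsingleton_quotient N V).1 this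

theorem Digraph.noCyclicNormalQuotient_of_card_le_two {V G : Type*} [Group G] [MulAction G V]
    {Γ : Digraph V} {v w w' : V} (hw : Γ.Adj v w) (hw' : Γ.Adj v w') (hne : w ≠ w')
    (h : ∀ N : Subgroup G, N.Normal → N ≠ ⊥ →
      ENat.card (MulAction.orbitRel.Quotient N V) ≤ 2) :
    Γ.NoCyclicNormalQuotient G := by
  refine fun N hN r hr => ⟨fun e => ?_⟩
  by_cases hbot : N = ⊥
  · -- Both out-neighbours of `v` are mapped to the unique out-neighbour of its image in the cycle.
    subst hbot
    have h1 := e.map_rel_iff.2 (show (Γ.orbitQuotient (⊥ : Subgroup G)).Adj _ _ from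
      ⟨v, w, rfl, rfl, hw⟩)
    have h2 := e.map_rel_iff.2 (show (Γ.orbitQuotient (⊥ : Subgroup G)).Adj _ _ from
      ⟨v, w', rfl, rfl, hw'⟩)
    have h3 := e.injective (Eq.trans h1 (Eq.symm h2))
    obtain ⟨⟨g, hg⟩, hgw⟩ := Quotient.exact h3
    obtain rfl := Subgroup.mem_bot.1 hg
    exact hne ((one_smul G w').symm.trans hgw).symm
  · have hcard := h N hN hbot
    rw [ENat.card_congr e.toEquiv] at hcard
    have : NeZero r := ⟨by omega⟩
    rw [ENat.card_eq_coe_natCard, Nat.card_zmod] at hcard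
    have : r ≤ 2 := by exact_mod_cast hcard
    omega

theorem hasEqualLengthOrbits_of_normal {G V : Type*} [Group G] [MulAction G V]
    [MulAction.IsPretransitive G V] (N : Subgroup G) [N.Normal] : HasEqualLengthOrbits N V := by
  intro v w
  obtain ⟨g, rfl⟩ := MulAction.exists_smul_eq G v w
  rw [← MulAction.smul_orbit_eq_orbit_smul]
  exact ((MulAction.injective g).encard_image _).symm

namespace CLP

variable {k s n : ℕ}

/-! ### The digraph `Δ` as a coset digraph -/

theorem Δ_eq_cosetDigraph : Δ k s n =
    cosetDigraph ((H k s n).subgroupOf (X k s n)) ⟨a k s n, a_mem_X k s n⟩ := rfl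

/-- An element `a h a` with `h ∈ H` moves the last tail point to the block of index `1`. -/
theorem a_mul_mul_a_notMem_H (hk : 2 ≤ k) (hs : 0 < s) (hn : 0 < n) {h : Equiv.Perm (Pt k s n)}
    (hh : h ∈ H k s n) : a k s n * h * a k s n ∉ H k s n := by
  intro hmem
  have h1 := apply_tailPt_of_mem_H hmem ⟨n - 1, by omega⟩
  obtain ⟨j, hj⟩ := exists_apply_blockPt_of_mem_H hh 0 ⟨0, by omega⟩
  rw [Equiv.Perm.mul_apply, Equiv.Perm.mul_apply,
    a_apply_tailPt_last hs hn ⟨0, by omega⟩ rfl, hj] at h1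
  have h2 := a_apply_blockPt (n := n) hs ⟨0, hs⟩ j
  exact blockPt_ne_tailPt _ _ _ (h2.symm.trans h1)

theorem isAsymm_Δ (hk : 2 ≤ k) (hs : 0 < s) (hn : 0 < n) : (Δ k s n).IsAsymm :=
  cosetDigraph.isAsymm fun _ hf => a_mul_mul_a_notMem_H hk hs hn hf

theorem subgroupOf_sup_closure_eq_top :
    (H k s n).subgroupOf (X k s n) ⊔ Subgroup.closure {⟨a k s n, a_mem_X k s n⟩} = ⊤ := by
  apply Subgroup.map_injective (X k s n).subtype_injective
  rw [Subgroup.map_sup, Subgroup.subgroupOf_map_subtype, MonoidHom.map_closure,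
    Set.image_singleton, ← MonoidHom.range_eq_map, Subgroup.range_subtype,
    inf_eq_left.2 H_le_X]
  rfl

theorem a_inv_mul_x_mul_a_mem_H (hs : 0 < s) (i : Fin (s + 1)) (hi : i ≠ 0) :
    (a k s n)⁻¹ * x k s n i * a k s n ∈ H k s n := by
  obtain ⟨i, rfl⟩ := Fin.exists_succ_eq.2 hi
  rw [← a_mul_x_mul_inv hs, mul_assoc, inv_mul_cancel_right, inv_mul_cancel_left]
  exact x_mem_H _

theorem a_mul_x_mul_a_inv_mem_H (hs : 0 < s) (i : Fin (s + 1)) (hi : i ≠ Fin.last s) :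
    a k s n * x k s n i * (a k s n)⁻¹ ∈ H k s n := by
  obtain ⟨i, rfl⟩ := Fin.exists_castSucc_eq.2 hi
  rw [a_mul_x_mul_inv hs]
  exact x_mem_H _

theorem exists_mul_eq_x_zpow_mul {b : Equiv.Perm (Pt k s n)} {i₀ : Fin (s + 1)}
    (hb : ∀ i, i ≠ i₀ → b⁻¹ * x k s n i * b ∈ H k s n) (hbX : b ∈ X k s n) (h : X k s n)
    (hh : h ∈ (H k s n).subgroupOf (X k s n)) :
    ∃ m : ℤ, ∃ h' ∈ (H k s n).subgroupOf (X k s n),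
      h * ⟨b, hbX⟩ = (⟨x k s n i₀, x_mem_X i₀⟩ : X k s n) ^ m * ⟨b, hbX⟩ * h' := by
  obtain ⟨m, h', hh', e⟩ := Subgroup.exists_mul_eq_zpow_mul_mul
    (fun f hf => commute_x_of_mem_H hf i₀) hb (Subgroup.mem_subgroupOf.1 hh)
  exact ⟨m, ⟨h', H_le_X hh'⟩, Subgroup.mem_subgroupOf.2 hh', Subtype.ext (by simpa using e)⟩

theorem x_zpow_eq_one (hk : 2 ≤ k) (i : Fin (s + 1)) (j : Fin k) {m : ℤ}
    (h : (x k s n i ^ m) (blockPt k s n i j) = blockPt k s n i j) : x k s n i ^ m = 1 := by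
  obtain ⟨l, hl⟩ := (isOfFinOrder_of_finite (x k s n i)).mem_powers_iff_mem_zpowers.2 ⟨m, rfl⟩
  change x k s n i ^ l = x k s n i ^ m at hl
  rw [← hl] at h ⊢
  exact (isCycle_x hk i).pow_eq_one_iff.2 ⟨_, x_apply_blockPt_ne hk i j, h⟩

theorem hasValency_Δ (hk : 2 ≤ k) (hs : 0 < s) (hn : 0 < n) : (Δ k s n).HasValency k := by
  intro v
  obtain ⟨g, rfl⟩ := QuotientGroup.mk_surjective v
  have hord : ∀ i, orderOf (⟨x k s n i, x_mem_X i⟩ : X k s n) = k := fun i => by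
    rw [Subgroup.orderOf_mk, orderOf_x hk]
  rw [Δ_eq_cosetDigraph]
  constructor
  · simp only [cosetDigraph.adj_mk_left]
    refine (cosetDigraph.encard_setOf_mk_mul (Subgroup.mem_subgroupOf.2 (x_mem_H 0))
      (exists_mul_eq_x_zpow_mul (a_inv_mul_x_mul_a_mem_H hs) (a_mem_X k s n))
      (fun m hm => ?_) g).trans (by rw [hord])
    have h1 := apply_tailPt_of_mem_H (Subgroup.mem_subgroupOf.1 hm) ⟨n - 1, by omega⟩
    refine Subtype.ext (x_zpow_eq_one hk 0 ⟨0, by omega⟩ ?_)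
    rw [← a_apply_tailPt_last hs hn ⟨0, by omega⟩ rfl]
    exact Equiv.Perm.inv_eq_iff_eq.1 h1
  · simp only [cosetDigraph.adj_mk_right]
    have hb : ∀ i, i ≠ Fin.last s →
        (a k s n)⁻¹⁻¹ * x k s n i * (a k s n)⁻¹ ∈ H k s n := fun i hi => by
      rw [inv_inv]
      exact a_mul_x_mul_a_inv_mem_H hs i hi
    refine (cosetDigraph.encard_setOf_mk_mul (Subgroup.mem_subgroupOf.2 (x_mem_H (Fin.last s)))
      (exists_mul_eq_x_zpow_mul hb (inv_mem (a_mem_X k s n)))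
      (fun m hm => ?_) g).trans (by rw [hord])
    have h1 := apply_tailPt_of_mem_H (Subgroup.mem_subgroupOf.1 hm) ⟨0, hn⟩
    have h2 : (a k s n)⁻¹ (tailPt k s n ⟨0, hn⟩) = blockPt k s n (Fin.last s) ⟨0, by omega⟩ := by
      rw [Equiv.Perm.inv_eq_iff_eq, a_apply_blockPt_last_zero hs hn _ rfl]
    refine Subtype.ext (x_zpow_eq_one hk _ ⟨0, by omega⟩ ?_)
    rw [← h2]
    exact Equiv.Perm.eq_inv_iff_eq.2 h1

theorem faithfulSMul_Vert (hk : 2 ≤ k) (hs : 0 < s) (hn : 0 < n) :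
    FaithfulSMul (X k s n) (Vert k s n) := by
  have := isPretransitive_X (n := n) hk hs
  refine ⟨fun {g g'} h => Subtype.ext (Equiv.ext fun p => ?_)⟩
  obtain ⟨f, rfl⟩ := MulAction.exists_smul_eq (X k s n) (tailPt k s n ⟨0, hn⟩) p
  have h1 : (QuotientGroup.mk (g * f) : Vert k s n) = QuotientGroup.mk (g' * f) :=
    h (QuotientGroup.mk f)
  have h2 := apply_tailPt_of_mem_H (Subgroup.mem_subgroupOf.1 (QuotientGroup.eq.1 h1)) ⟨0, hn⟩
  exact ((g * f : X k s n) : Equiv.Perm (Pt k s n)).symm_apply_eq.1 h2 |>.symm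

theorem isSArcTransitive_Δ (hs : 0 < s) : (Δ k s n).IsSArcTransitive (X k s n) s := by
  rw [Δ_eq_cosetDigraph]
  refine cosetDigraph.isSArcTransitive
    (fun t => ⟨x k s n (Fin.ofNat (s + 1) t), x_mem_X _⟩)
    (fun t _ => Subgroup.mem_subgroupOf.2 (x_mem_H _)) (fun t ht => Subtype.ext ?_)
    (exists_mul_eq_x_zpow_mul (a_inv_mul_x_mul_a_mem_H hs) (a_mem_X k s n))
  have h1 : Fin.ofNat (s + 1) (t + 1) = (⟨t, by omega⟩ : Fin s).succ :=
    Fin.ext (Nat.mod_eq_of_lt (by omega))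
  have h2 : Fin.ofNat (s + 1) t = (⟨t, by omega⟩ : Fin s).castSucc :=
    Fin.ext (Nat.mod_eq_of_lt (by omega))
  rw [h1, h2]
  change x k s n _ * a k s n = a k s n * x k s n _
  rw [← a_mul_x_mul_inv hs, inv_mul_cancel_right]

theorem isPreFamilyD_Δ (hk : 2 ≤ k) (hs : 0 < s) (hn : 0 < n)
    (h : IsQuasiprimitiveAction (X k s n) (Vert k s n) ∨
      IsBiquasiprimitiveAction (X k s n) (Vert k s n)) :
    (Δ k s n).IsPreFamilyD (X k s n) s where
  finite := inferInstance
  asymm := isAsymm_Δ hk hs hn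
  connected := cosetDigraph.connected (fun _ hf => a_mul_mul_a_notMem_H hk hs hn hf)
    subgroupOf_sup_closure_eq_top
  autGroup := ⟨faithfulSMul_Vert hk hs hn, cosetDigraph.smul_adj_smul_iff⟩
  vertexTransitive := inferInstance
  sArcTransitive := isSArcTransitive_Δ hs
  noCyclicQuotient := by
    have hval := (hasValency_Δ (n := n) hk hs hn (QuotientGroup.mk 1)).1
    have hlt : 1 < {w | (Δ k s n).Adj (QuotientGroup.mk 1) w}.encard := by
      rw [hval]
      exact_mod_cast hk
    obtain ⟨w, w', hw, hw', hne⟩ := Set.one_lt_encard_iff.1 hlt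
    refine Digraph.noCyclicNormalQuotient_of_card_le_two hw hw' hne fun N hN hbot => ?_
    rcases h with h | h
    · exact (h.card_le N hN hbot).trans one_le_two
    · exact (h.1 N hN hbot).1

/-! ### Quasiprimitivity and parity -/

theorem isQuasiprimitiveAction_of_sign (hk : 2 ≤ k) (hs : 0 < s) (hn : 0 < n)
    (hc : Nat.gcd n (s + 1) = 1)
    (hpar : ∀ g ∈ X k s n, ∃ h ∈ H k s n, Equiv.Perm.sign h = Equiv.Perm.sign g) :
    IsQuasiprimitiveAction (X k s n) (Vert k s n) := by
  refine fun N hN hne => ⟨fun u v => ?_⟩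
  obtain ⟨g, rfl⟩ := QuotientGroup.mk_surjective u
  obtain ⟨g', rfl⟩ := QuotientGroup.mk_surjective v
  obtain ⟨h, hh, hsign⟩ := hpar _ (g'⁻¹ * g).2
  let h' : X k s n := ⟨h, H_le_X hh⟩
  have hmem : g' * h' * g⁻¹ ∈ N := by
    refine mem_of_normal hk hs hn hc hN hne ?_
    simp only [Subgroup.coe_mul, Subgroup.coe_inv, map_mul, map_inv] at hsign ⊢
    rw [hsign, mul_inv_cancel_left, mul_inv_cancel]
  refine ⟨⟨_, hmem⟩, ?_⟩
  change (QuotientGroup.mk (g' * h' * g⁻¹ * g) : Vert k s n) = _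
  rw [inv_mul_cancel_right]
  exact QuotientGroup.mk_mul_of_mem g' (Subgroup.mem_subgroupOf.2 hh)

theorem not_isBipartite_Δ (hk : 2 ≤ k) (hs : 0 < s) (hn : 0 < n)
    (h : IsQuasiprimitiveAction (X k s n) (Vert k s n)) :
    ¬ (Δ k s n).toSimpleGraphInclusive.IsBipartite := by
  refine cosetDigraph.not_isBipartite (fun _ hf => a_mul_mul_a_notMem_H hk hs hn hf)
    subgroupOf_sup_closure_eq_top ⟨⟨a k s n, a_mem_X k s n⟩, fun h1 => ?_⟩ h
  apply a_mul_mul_a_notMem_H hk hs hn (one_mem (H k s n))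
  rw [mul_one, show a k s n * a k s n = 1 from congrArg Subtype.val h1]
  exact one_mem _

theorem sign_eq_one_of_mem_H (hx : ∀ i, Equiv.Perm.sign (x k s n i) = 1)
    {h : Equiv.Perm (Pt k s n)} (hh : h ∈ H k s n) : Equiv.Perm.sign h = 1 := by
  have : H k s n ≤ alternatingGroup (Pt k s n) := by
    rw [H, Subgroup.closure_le]
    rintro _ ⟨i, rfl⟩
    exact hx i
  exact this hh

/-- If `H` consists of even permutations, the sign of a vertex is the sign of any representative. -/
def vertSign (hx : ∀ i, Equiv.Perm.sign (x k s n i) = 1) (v : Vert k s n) : ℤˣ :=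
  Quotient.liftOn' v (fun g => Equiv.Perm.sign (g : Equiv.Perm (Pt k s n))) fun g g' h => by
    have h1 := sign_eq_one_of_mem_H hx
      (Subgroup.mem_subgroupOf.1 (QuotientGroup.leftRel_apply.1 h))
    rw [Subgroup.coe_mul, map_mul, Subgroup.coe_inv, map_inv, inv_mul_eq_one] at h1
    exact h1

theorem vertSign_mk (hx : ∀ i, Equiv.Perm.sign (x k s n i) = 1) (g : X k s n) :
    vertSign hx (QuotientGroup.mk g) = Equiv.Perm.sign (g : Equiv.Perm (Pt k s n)) := rfl

theorem isBipartite_Δ (hx : ∀ i, Equiv.Perm.sign (x k s n i) = 1)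
    (ha : Equiv.Perm.sign (a k s n) = -1) : (Δ k s n).toSimpleGraphInclusive.IsBipartite := by
  have hadj : ∀ u v, (Δ k s n).Adj u v → vertSign hx u ≠ vertSign hx v := by
    rintro _ _ ⟨g, rfl, rfl⟩
    rw [vertSign_mk, vertSign_mk, Subgroup.coe_mul, map_mul, ha, mul_neg_one]
    exact units_ne_neg_self _
  let C : (Δ k s n).toSimpleGraphInclusive.Coloring ℤˣ := SimpleGraph.Coloring.mk (vertSign hx)
    fun {u v} h => h.2.elim (hadj u v) fun h' => (hadj v u h').symm
  exact C.colorable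

theorem isBiquasiprimitiveAction_of_sign (hk : 2 ≤ k) (hs : 0 < s) (hn : 0 < n)
    (hc : Nat.gcd n (s + 1) = 1) (hx : ∀ i, Equiv.Perm.sign (x k s n i) = 1)
    (ha : Equiv.Perm.sign (a k s n) = -1) :
    IsBiquasiprimitiveAction (X k s n) (Vert k s n) := by
  have hcard : ENat.card ℤˣ = 2 := by simp
  let A : X k s n := ⟨a k s n, a_mem_X k s n⟩
  constructor
  · refine fun N hN hne => ⟨?_, hasEqualLengthOrbits_of_normal N⟩
    -- There are representatives of both signs, and the sign determines the orbit.
    rw [← hcard]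
    let f : ℤˣ → MulAction.orbitRel.Quotient N (Vert k s n) := fun e =>
      Quotient.mk _ (if e = 1 then QuotientGroup.mk 1 else QuotientGroup.mk A)
    have hf : Function.Surjective f := by
      intro U
      induction U using Quotient.inductionOn with | h u =>
      obtain ⟨g, rfl⟩ := QuotientGroup.mk_surjective u
      have hsame : ∀ g' : X k s n, Equiv.Perm.sign (g' : Equiv.Perm (Pt k s n)) =
          Equiv.Perm.sign (g : Equiv.Perm (Pt k s n)) →
          (Quotient.mk (MulAction.orbitRel N (Vert k s n)) (QuotientGroup.mk g')) =
            Quotient.mk _ (QuotientGroup.mk g) := by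
        intro g' hg'
        apply Quotient.sound
        refine ⟨⟨g' * g⁻¹, mem_of_normal hk hs hn hc hN hne ?_⟩, ?_⟩
        · simp [hg']
        · change (QuotientGroup.mk (g' * g⁻¹ * g) : Vert k s n) = _
          rw [inv_mul_cancel_right]
      refine ⟨Equiv.Perm.sign (g : Equiv.Perm (Pt k s n)), ?_⟩
      rcases Int.units_eq_one_or (Equiv.Perm.sign (g : Equiv.Perm (Pt k s n))) with h | h
      · simp only [f, h, if_true]
        exact hsame 1 (by simp [h])
      · simp only [f, h, if_neg (show (-1 : ℤˣ) ≠ 1 by decide)]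
        exact hsame A (ha.trans h.symm)
    exact ENat.card_le_card_of_injective (Function.injective_surjInv hf)
  · let N : Subgroup (X k s n) := (Equiv.Perm.sign.comp (X k s n).subtype).ker
    refine ⟨N, inferInstance, ?_⟩
    rw [← hcard]
    let f : MulAction.orbitRel.Quotient N (Vert k s n) → ℤˣ := Quotient.lift (vertSign hx) <| by
      rintro _ v ⟨⟨m, hm⟩, rfl⟩
      obtain ⟨g, rfl⟩ := QuotientGroup.mk_surjective v
      have hm' : Equiv.Perm.sign (m : Equiv.Perm (Pt k s n)) = 1 := hm
      change vertSign hx (QuotientGroup.mk (m * g)) = _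
      rw [vertSign_mk, vertSign_mk, Subgroup.coe_mul, map_mul, hm', one_mul]
    refine ENat.card_congr (Equiv.ofBijective f ⟨fun U U' => ?_, fun e => ?_⟩)
    · induction U using Quotient.inductionOn with | h u =>
      induction U' using Quotient.inductionOn with | h u' =>
      obtain ⟨g, rfl⟩ := QuotientGroup.mk_surjective u
      obtain ⟨g', rfl⟩ := QuotientGroup.mk_surjective u'
      intro hsign
      change Equiv.Perm.sign (g : Equiv.Perm (Pt k s n)) =
        Equiv.Perm.sign (g' : Equiv.Perm (Pt k s n)) at hsign
      apply Quotient.sound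
      refine ⟨⟨g * g'⁻¹, ?_⟩, ?_⟩
      · simp [N, MonoidHom.mem_ker, hsign]
      · change (QuotientGroup.mk (g * g'⁻¹ * g') : Vert k s n) = _
        rw [inv_mul_cancel_right]
    · rcases Int.units_eq_one_or e with rfl | rfl
      · exact ⟨Quotient.mk _ (QuotientGroup.mk 1), Equiv.Perm.sign_one⟩
      · exact ⟨Quotient.mk _ (QuotientGroup.mk A), ha⟩

/-- The base vertex and its `k` out-neighbours are already more than two vertices. -/
theorem two_lt_card_Vert (hk : 2 ≤ k) (hs : 0 < s) (hn : 0 < n) :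
    2 < ENat.card (Vert k s n) := by
  let v : Vert k s n := QuotientGroup.mk 1
  have hv : v ∉ {w | (Δ k s n).Adj v w} := fun h =>
    isAsymm_Δ hk hs hn v v h h
  have hle := Set.encard_le_encard (Set.subset_univ (insert v {w | (Δ k s n).Adj v w}))
  rw [Set.encard_insert_of_notMem hv, (hasValency_Δ hk hs hn v).1, Set.encard_univ] at hle
  refine lt_of_lt_of_le ?_ hle
  exact_mod_cast Nat.lt_succ_iff.2 hk

theorem not_isBiquasiprimitiveAction (hk : 2 ≤ k) (hs : 0 < s) (hn : 0 < n)
    (h : IsQuasiprimitiveAction (X k s n) (Vert k s n)) :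
    ¬ IsBiquasiprimitiveAction (X k s n) (Vert k s n) := by
  rintro ⟨-, N, hN, hcard⟩
  by_cases hbot : N = ⊥
  · subst hbot
    refine absurd (ENat.card_le_card_of_injective (α := Vert k s n)
      (f := Quotient.mk (MulAction.orbitRel (⊥ : Subgroup (X k s n)) (Vert k s n))) ?_)
      (not_le.2 (hcard.trans_lt (two_lt_card_Vert hk hs hn)))
    intro u v huv
    obtain ⟨⟨g, hg⟩, hgv⟩ := Quotient.exact huv
    obtain rfl := Subgroup.mem_bot.1 hg
    exact hgv.symm.trans (one_smul _ v)
  · have := h.card_le N hN hbot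
    rw [hcard] at this
    exact absurd this (by norm_num)

/-! ### The table -/

theorem symQuasiprimitive (hk : 2 ≤ k) (hs : 0 < s) (hn : 0 < n) (hc : Nat.gcd n (s + 1) = 1)
    (hk2 : Even k) : SymQuasiprimitive k s n := by
  have hx : Equiv.Perm.sign (x k s n 0) = -1 := by
    rw [sign_x, Odd.neg_one_pow (Nat.Even.sub_odd (by omega) hk2 odd_one)]
  have hq := isQuasiprimitiveAction_of_sign hk hs hn hc fun g _ =>
    (Int.units_eq_one_or (Equiv.Perm.sign g)).elim
      (fun h => ⟨1, one_mem _, Equiv.Perm.sign_one.trans h.symm⟩)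
      fun h => ⟨_, x_mem_H 0, hx.trans h.symm⟩
  exact ⟨X_eq_top hk hs hn hc (x_mem_X 0) hx, hq, not_isBipartite_Δ hk hs hn hq⟩

theorem sign_x_of_odd (hk2 : Odd k) (i : Fin (s + 1)) : Equiv.Perm.sign (x k s n i) = 1 := by
  rw [sign_x, (Nat.Odd.sub_odd hk2 odd_one).neg_one_pow]

theorem sign_a_of_odd (hk2 : Odd k) : Equiv.Perm.sign (a k s n) = (-1) ^ (s + n) := by
  rw [sign_a hk2.pos, pow_right_comm, (Nat.Odd.sub_odd hk2 odd_one).neg_one_pow, one_pow, mul_one]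

theorem altQuasiprimitive (hk : 2 ≤ k) (hs : 0 < s) (hn : 0 < n) (hc : Nat.gcd n (s + 1) = 1)
    (hk2 : Odd k) (hsn : Even (s + n)) : AltQuasiprimitive k s n := by
  have hX := X_eq_alternatingGroup hk hs hn hc (sign_x_of_odd hk2)
    ((sign_a_of_odd hk2).trans hsn.neg_one_pow)
  have hq := isQuasiprimitiveAction_of_sign hk hs hn hc fun g hg =>
    ⟨1, one_mem _, Equiv.Perm.sign_one.trans (Equiv.Perm.mem_alternatingGroup.1 (hX ▸ hg)).symm⟩
  exact ⟨hX, hq, not_isBipartite_Δ hk hs hn hq⟩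

theorem symBiquasiprimitive (hk : 2 ≤ k) (hs : 0 < s) (hn : 0 < n) (hc : Nat.gcd n (s + 1) = 1)
    (hk2 : Odd k) (hsn : Odd (s + n)) : SymBiquasiprimitive k s n := by
  have ha := (sign_a_of_odd (s := s) (n := n) hk2).trans hsn.neg_one_pow
  exact ⟨X_eq_top hk hs hn hc (a_mem_X k s n) ha,
    isBiquasiprimitiveAction_of_sign hk hs hn hc (sign_x_of_odd hk2) ha,
    isBipartite_Δ (sign_x_of_odd hk2) ha⟩

theorem even_of_even (hc : Nat.gcd n (s + 1) = 1) (hn : Even n) : Even s := by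
  by_contra hs
  have h := Nat.dvd_gcd hn.two_dvd (Nat.not_even_iff_odd.1 hs).add_one.two_dvd
  rw [hc] at h
  omega

theorem exists_tableLine (hk : 2 ≤ k) (hs : 0 < s) (hn : 0 < n) (hc : Nat.gcd n (s + 1) = 1) :
    ∃ i, TableLine k s n i := by
  rcases Nat.even_or_odd k with hk2 | hk2
  · have h := symQuasiprimitive hk hs hn hc hk2
    rcases Nat.even_or_odd n with hn2 | hn2
    · exact ⟨0, hk2, hn2, even_of_even hc hn2, h⟩
    · exact ⟨1, hk2, hn2, h⟩
  · rcases Nat.even_or_odd n with hn2 | hn2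
    · have hs2 := even_of_even hc hn2
      exact ⟨3, hk2, hn2, hs2, altQuasiprimitive hk hs hn hc hk2 (hs2.add hn2)⟩
    · rcases Nat.even_or_odd s with hs2 | hs2
      · exact ⟨4, hk2, hn2, hs2, symBiquasiprimitive hk hs hn hc hk2 (hs2.add_odd hn2)⟩
      · exact ⟨2, hk2, hn2, hs2, altQuasiprimitive hk hs hn hc hk2 (hs2.add_odd hn2)⟩

/-- The parity conditions of the five lines exclude each other. -/
theorem tableLine_unique {i j : Fin 5} (hi : TableLine k s n i) (hj : TableLine k s n j) :
    i = j := by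
  fin_cases i <;> fin_cases j <;> simp [TableLine] at hi hj ⊢ <;> grind

theorem isQuasiprimitiveAction_of_not (hk : 2 ≤ k) (hs : 0 < s) (hn : 0 < n)
    (hc : Nat.gcd n (s + 1) = 1) (h : ¬ (Odd (k * n) ∧ Even s)) :
    IsQuasiprimitiveAction (X k s n) (Vert k s n) := by
  rcases Nat.even_or_odd k with hk2 | hk2
  · exact (symQuasiprimitive hk hs hn hc hk2).2.1
  · refine (altQuasiprimitive hk hs hn hc hk2 ?_).2.1
    rcases Nat.even_or_odd n with hn2 | hn2
    · exact (even_of_even hc hn2).add hn2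
    · exact (Nat.not_even_iff_odd.1 fun hs2 => h ⟨hk2.mul hn2, hs2⟩).add_odd hn2

theorem isBiquasiprimitiveAction_iff (hk : 2 ≤ k) (hs : 0 < s) (hn : 0 < n)
    (hc : Nat.gcd n (s + 1) = 1) :
    IsBiquasiprimitiveAction (X k s n) (Vert k s n) ↔ Odd (k * n) ∧ Even s := by
  refine ⟨fun h => ?_, fun ⟨hkn, hs2⟩ => ?_⟩
  · by_contra hnot
    exact not_isBiquasiprimitiveAction hk hs hn (isQuasiprimitiveAction_of_not hk hs hn hc hnot) h
  · rw [Nat.odd_mul] at hkn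
    exact (symBiquasiprimitive hk hs hn hc hkn.1 (hs2.add_odd hkn.2)).2.1

theorem isPreFamilyD (hk : 2 ≤ k) (hs : 0 < s) (hn : 0 < n) (hc : Nat.gcd n (s + 1) = 1) :
    (Δ k s n).IsPreFamilyD (X k s n) s := by
  refine isPreFamilyD_Δ hk hs hn ?_
  by_cases h : Odd (k * n) ∧ Even s
  · exact Or.inr ((isBiquasiprimitiveAction_iff hk hs hn hc).2 h)
  · exact Or.inl (isQuasiprimitiveAction_of_not hk hs hn hc h)

end CLP

theorem proposition6p3 :
    (∀ k s n : ℕ, 2 ≤ k → 0 < s → 0 < n → Nat.gcd n (s + 1) = 1 →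
      (∃! i : Fin 5, CLP.TableLine k s n i) ∧
      (CLP.Δ k s n).IsPreFamilyD (CLP.X k s n) s ∧
      (2 ≤ s → (CLP.Δ k s n).MemFamilyD (CLP.X k s n) s) ∧
      (IsBiquasiprimitiveAction (CLP.X k s n) (CLP.Vert k s n) ↔ Odd (k * n) ∧ Even s)) ∧
    (∀ k s : ℕ, Even s → 0 < s → Odd k → 1 < k →
      {n : ℕ | 0 < n ∧ Nat.gcd n (s + 1) = 1 ∧
        (CLP.Δ k s n).MemFamilyD (CLP.X k s n) s ∧ (CLP.Δ k s n).HasValency k ∧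
        IsBiquasiprimitiveAction (CLP.X k s n) (CLP.Vert k s n)}.Infinite ∧
      {n : ℕ | 0 < n ∧ Nat.gcd n (s + 1) = 1 ∧
        (CLP.Δ k s n).MemFamilyD (CLP.X k s n) s ∧ (CLP.Δ k s n).HasValency k ∧
        IsQuasiprimitiveAction (CLP.X k s n) (CLP.Vert k s n)}.Infinite) := by
  refine ⟨fun k s n hk hs hn hc => ?_, fun k s hs2 hs hk2 hk => ?_⟩
  · obtain ⟨i, hi⟩ := CLP.exists_tableLine hk hs hn hc
    have hpre := CLP.isPreFamilyD hk hs hn hc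
    exact ⟨⟨i, hi, fun j hj => CLP.tableLine_unique hj hi⟩, hpre, fun h => ⟨hpre, h⟩,
      CLP.isBiquasiprimitiveAction_iff hk hs hn hc⟩
  · have hs' : 2 ≤ s := by
      obtain ⟨r, rfl⟩ := hs2
      omega
    -- Numbers `n` of either parity: those congruent to `1` or `2` modulo `2 (s + 1)`.
    have hinj : ∀ c, Function.Injective fun m : ℕ => c + 2 * (s + 1) * m := fun c m m' h =>
      Nat.eq_of_mul_eq_mul_left (show 0 < 2 * (s + 1) by omega) (Nat.add_left_cancel h)
    have hgcd : ∀ c m, Nat.gcd (c + 2 * (s + 1) * m) (s + 1) = Nat.gcd c (s + 1) := fun c m => by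
      rw [mul_comm 2, mul_assoc, Nat.gcd_add_mul_left_left]
    constructor
    · refine (Set.infinite_range_of_injective (hinj 1)).mono ?_
      rintro _ ⟨m, rfl⟩
      have hn : 0 < 1 + 2 * (s + 1) * m := by omega
      have hc := (hgcd 1 m).trans (Nat.gcd_one_left _)
      refine ⟨hn, hc, ⟨CLP.isPreFamilyD hk hs hn hc, hs'⟩, CLP.hasValency_Δ hk hs hn, ?_⟩
      refine (CLP.isBiquasiprimitiveAction_iff hk hs hn hc).2 ⟨hk2.mul ?_, hs2⟩
      exact odd_one.add_even ((even_two_mul _).mul_right m)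
    · refine (Set.infinite_range_of_injective (hinj 2)).mono ?_
      rintro _ ⟨m, rfl⟩
      have hn : 0 < 2 + 2 * (s + 1) * m := by omega
      have hc := (hgcd 2 m).trans (Nat.coprime_two_left.2 hs2.add_one)
      refine ⟨hn, hc, ⟨CLP.isPreFamilyD hk hs hn hc, hs'⟩, CLP.hasValency_Δ hk hs hn, ?_⟩
      refine CLP.isQuasiprimitiveAction_of_not hk hs hn hc fun h => ?_
      have he : Even (2 + 2 * (s + 1) * m) := even_two.add ((even_two_mul _).mul_right m)
      exact Nat.not_even_iff_odd.2 h.1 (he.mul_left k)
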